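/- **Mean-payoff games.** Let $G$ be a mean-payoff game: a finite directed graph $(V,E)$ in which every vertex has an outgoing edge, a finite set $\Pi$ of players, a partition $(V_j)_{j\in\Pi}$ of $V$, and rewards $r_j:E\to\mathbb{Q}$. A play is an infinite path, a history is a finite path (possibly empty), and $\mu_j(\rho)=\liminf_{n\to\infty}\frac1n\sum_{k<n}r_j(\rho_k\rho_{k+1})$. $\mathsf{Occ}(\rho)$ is the set of vertices visited by $\rho$. For a requirement $\lambda:V\to\mathbb{R}\cup\{\pm\infty\}$, a play $\rho$ is $\lambda$-consistent if $\mu_j(\rho_{\ge n})\ge\lambda(\rho_n)$ whenever $\rho_n\in V_j$. **Punishment families.** The size of a rational $p/q$ in lowest terms is $1+\lceil\log_2(|p|+1)\rceil+\lceil\log_2(|q|+1)\rceil$, the size of an irrational number is $+\infty$, and the size of $\bar x\in\mathbb{R}^\Pi$ is $|\Pi|$ plus the sum of the sizes of its entries. A $\beta$-punishment family $hc^\infty\rho$ is given by a (possibly empty) simple history $h$, a nonempty simple cycle $c$, a vector $\bar x\in\mathbb{R}^\Pi$ of size at most $\beta$ and a set $W\subseteq V$ such that the set of plays $\{hc^n\rho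 \mid n>0,\ \mu(\rho)=\bar x,\ \mathsf{Occ}(\rho)=W\}$ is nonempty; it is determined by these data $(h,c,\bar x,W)$. It is $\lambda$-consistent if all plays of this set are. **The reduced negotiation game.** Let $i\in\Pi$, $v_0\in V_i$ and $\beta\in\mathbb{N}$. The reduced negotiation game $\mathsf{Red}^\beta_{\lambda i}(G)_{\|v_0}$ is the following zero-sum game between Prover and Challenger, starting at $v_0$. - Prover controls the states $v\in V$. From $v$ she goes to $\bot$, or to a state $[hc^\infty\rho]$, where $hc^\infty\rho$ is a $\lambda$-consistent $\beta$-punishment family whose plays start at $v$. - Challenger controls all other states. From $[hc^\infty\rho]$ he goes to $\top$; or to $[h'v]$, where $h'$ is a prefix of $hc$ whose last vertex is in $V_i$ and $h'v$ is a history; or to $(c,u)$, where some vertex of $\mathsf{Occ}(\rho)\cap V_i$ has an edge to $u$. From $[h'v]$ the game goes to $v$, from $(c,u)$ to $u$, and $\top$ and $\bot$ only have a self-loop. - A play $\pi$ that does not reach $\bot$ is interpreted as a play $\dot\pi$ of $G$, built as follows. Let $g$ be the history built so far (initially empty). A transition $[hc^\infty\rho]\to[h'v]$ appends $h'$. A transition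 $[hc^\infty\rho]\to(c,u)$ appends $hc^{|gh|^2}h'$, where $h'$ is one of the shortest nonempty histories that stay in $\mathsf{Occ}(\rho)$, start at a successor of the last vertex of $c$, and end in a vertex of $V_i$ with an edge to $u$. A transition $[hc^\infty\rho]\to\top$ appends $hc^{|gh|^2}\rho$. All other transitions append nothing. (The choices of the representative $\rho$ and of the shortest $h'$ are arbitrary but fixed.) - Challenger's payoff is $\nu_{\mathbb C}(\pi)=+\infty$ if $\pi$ reaches $\bot$, and $\nu_{\mathbb C}(\pi)=\mu_i(\dot\pi)$ otherwise. Prover's payoff is $\nu_{\mathbb P}=-\nu_{\mathbb C}$. **Lemma.** For all such $G,\lambda,i,v_0,\beta$ (and whatever the fixed choices), Prover has a memoryless optimal strategy in $\mathsf{Red}^\beta_{\lambda i}(G)_{\|v_0}$: there is a strategy $\tau_{\mathbb P}$ of Prover, whose choice after a history depends only on its last state, such that $$\inf_{\tau_{\mathbb C}}\nu_{\mathbb P}(\langle\tau_{\mathbb P},\tau_{\mathbb C}\rangle)=\sup_{\sigma_{\mathbb P}}\inf_{\tau_{\mathbb C}}\nu_{\mathbb P}(\langle\sigma_{\mathbb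 P},\tau_{\mathbb C}\rangle)=\inf_{\tau_{\mathbb C}}\sup_{\sigma_{\mathbb P}}\nu_{\mathbb P}(\langle\sigma_{\mathbb P},\tau_{\mathbb C}\rangle),$$ where $\sigma_{\mathbb P},\tau_{\mathbb C}$ range over all strategies and $\langle\cdot,\cdot\rangle$ denotes the outcome. -/

import Mathlib

open Filter

/-- A directed graph whose vertices are partitioned between players and in which every vertex
has an outgoing edge. -/
structure Arena (P S : Type*) where
  owner : S → P
  Edge : S → S → Prop
  exists_edge : ∀ s, ∃ t, Edge s t

namespace Arena

variable {P S : Type*}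

/-- Plays: infinite paths. -/
def IsPlay (A : Arena P S) (ρ : ℕ → S) : Prop := ∀ n, A.Edge (ρ n) (ρ (n + 1))

/-- Nonempty histories (finite paths) starting from `s₀`. -/
def IsHistFrom (A : Arena P S) (s₀ : S) (l : List S) : Prop :=
  l.head? = some s₀ ∧ l.IsChain A.Edge

/-- A strategy of player `p` in the arena initialized at `s₀`: `next h s` is the vertex chosen
after the history `hs`. Only its values on histories from `s₀` ending in a vertex of `p`
are ever used. -/
structure Strategy (A : Arena P S) (s₀ : S) (p : P) where
  next : List S → S → S
  edge_next : ∀ h s, A.IsHistFrom s₀ (h ++ [s]) → A.owner s = p → A.Edge s (next h s)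

/-- The choice after `hs` depends only on `s`. -/
def Strategy.IsMemoryless {A : Arena P S} {s₀ : S} {p : P} (σ : A.Strategy s₀ p) : Prop :=
  ∀ h h' s, A.IsHistFrom s₀ (h ++ [s]) → A.IsHistFrom s₀ (h' ++ [s]) → A.owner s = p →
    σ.next h s = σ.next h' s

/-- The prefix of length `n` and the `n`-th vertex of the play generated by a complete
strategy profile. -/
def outcomeAux (A : Arena P S) (s₀ : S) (σ : ∀ p, A.Strategy s₀ p) : ℕ → List S × S
  | 0 => ([], s₀)
  | n + 1 =>
    ((outcomeAux A s₀ σ n).1 ++ [(outcomeAux A s₀ σ n).2],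
      (σ (A.owner (outcomeAux A s₀ σ n).2)).next
        (outcomeAux A s₀ σ n).1 (outcomeAux A s₀ σ n).2)

/-- The outcome of a complete strategy profile. -/
def outcome (A : Arena P S) (s₀ : S) (σ : ∀ p, A.Strategy s₀ p) : ℕ → S :=
  fun n => (outcomeAux A s₀ σ n).2

end Arena

/-- A game: an arena with a payoff function for each player. -/
structure Game (P S : Type*) extends Arena P S where
  payoff : P → (ℕ → S) → EReal

/-- The two players of a negotiation game. -/
inductive Role where
  | prover
  | challenger

namespace Game

variable {S : Type*}

/-- The profile made of a strategy of Prover and a strategy of Challenger. -/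
def profile (G : Game Role S) {s₀ : S} (σ : G.Strategy s₀ Role.prover)
    (τ : G.Strategy s₀ Role.challenger) : ∀ p, G.Strategy s₀ p
  | Role.prover => σ
  | Role.challenger => τ

/-- Prover's payoff in the outcome of a pair of strategies. -/
def proverPayoff (G : Game Role S) {s₀ : S} (σ : G.Strategy s₀ Role.prover)
    (τ : G.Strategy s₀ Role.challenger) : EReal :=
  G.payoff Role.prover (G.outcome s₀ (G.profile σ τ))

/-- `x` is the value (for Prover) of the game initialized at `s₀`: the common value of
`sup inf` and `inf sup`. -/
def IsValue (G : Game Role S) (s₀ : S) (x : EReal) : Prop :=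
  (⨆ σ : G.Strategy s₀ Role.prover, ⨅ τ : G.Strategy s₀ Role.challenger,
    G.proverPayoff σ τ) = x ∧
  (⨅ τ : G.Strategy s₀ Role.challenger, ⨆ σ : G.Strategy s₀ Role.prover,
    G.proverPayoff σ τ) = x

/-- A strategy of Prover is optimal if the payoff that it guarantees is the value. -/
def IsOptimal (G : Game Role S) {s₀ : S} (σ : G.Strategy s₀ Role.prover) : Prop :=
  G.IsValue s₀ (⨅ τ : G.Strategy s₀ Role.challenger, G.proverPayoff σ τ)

end Game

/-- The infinite word `lρ`. -/
def appendPlay {V : Type*} (l : List V) (ρ : ℕ → V) : ℕ → V :=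
  fun n => if h : n < l.length then l[n] else ρ (n - l.length)

/-- The finite word `cⁿ`. -/
def wordPow {V : Type*} (c : List V) (n : ℕ) : List V := (List.replicate n c).flatten

open Classical in
/-- The infinite word of which all the words `L 0`, `L 1`, ... (each a prefix of the next one,
of unbounded lengths) are prefixes; `d` is a dummy letter. -/
noncomputable def limitWord {V : Type*} (d : V) (L : ℕ → List V) : ℕ → V :=
  fun k => if h : ∃ n, k < (L n).length then (L (Nat.find h))[k]'(Nat.find_spec h) else d

/-- A mean-payoff game (played on a finite graph once `V` and `P` are finite).
Rewards of pairs that are not edges are irrelevant. -/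
structure MeanPayoffGame (P V : Type*) extends Arena P V where
  reward : P → V → V → ℚ

namespace MeanPayoffGame

variable {P V : Type*}

/-- `μ_p(ρ)`: the limit inferior of the average rewards of player `p` along `ρ`. -/
noncomputable def mu (G : MeanPayoffGame P V) (p : P) (ρ : ℕ → V) : ℝ :=
  liminf (fun n : ℕ => (∑ k ∈ Finset.range n, (G.reward p (ρ k) (ρ (k + 1)) : ℝ)) / (n : ℝ)) atTop

/-- `lam`-consistency of a play, for a requirement `lam`. -/
def IsConsistent (G : MeanPayoffGame P V) (lam : V → EReal) (ρ : ℕ → V) : Prop :=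
  ∀ n, lam (ρ n) ≤ (G.mu (G.owner (ρ n)) (fun k => ρ (n + k)) : EReal)

end MeanPayoffGame

/-- The size of a rational number; `Nat.clog 2 m` is the ceiling of the binary logarithm. -/
def ratSize (q : ℚ) : ℕ := 1 + Nat.clog 2 (q.num.natAbs + 1) + Nat.clog 2 (q.den + 1)

/-- The size of a tuple of rational numbers. -/
def tupleSize {P : Type*} [Fintype P] (x : P → ℚ) : ℕ := Fintype.card P + ∑ p, ratSize (x p)

section Families

variable {P V : Type*}

/-- The punishment family `h c^∞ ρ` given by its representation: `h`, `c`, the payoff vector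
`x` of `ρ` and the set `W` of vertices that `ρ` visits. (Irrational numbers have
infinite size, so families of bounded size have rational payoff vectors.) -/
structure PunishmentData (P V : Type*) where
  h : List V
  c : List V
  x : P → ℚ
  W : Set V

/-- `ρ` is a play that may stand after `h c` in the family. -/
def PunishmentData.IsTail (G : MeanPayoffGame P V) (D : PunishmentData P V) (ρ : ℕ → V) : Prop :=
  G.IsPlay (appendPlay (D.h ++ D.c) ρ) ∧ (∀ p, G.mu p ρ = (D.x p : ℝ)) ∧ Set.range ρ = D.W

/-- The set of plays `{h cⁿ ρ | n > 0, μ(ρ) = x, Occ(ρ) = W}`. -/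
def PunishmentData.plays (G : MeanPayoffGame P V) (D : PunishmentData P V) : Set (ℕ → V) :=
  {ξ | ∃ n > 0, ∃ ρ, D.IsTail G ρ ∧ ξ = appendPlay (D.h ++ wordPow D.c n) ρ}

/-- The `lam`-consistent `β`-punishment families of `G`. The word `h` may be empty. -/
structure ConsFamily [Fintype P] (G : MeanPayoffGame P V) (lam : V → EReal) (β : ℕ)
    extends PunishmentData P V where
  h_simple : h.Nodup
  c_ne_nil : c ≠ []
  c_simple : c.Nodup
  c_cycle : (c ++ [c.head c_ne_nil]).IsChain G.Edge
  exists_tail : ∃ ρ, toPunishmentData.IsTail G ρ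
  size_le : tupleSize x ≤ β
  consistent : ∀ ξ ∈ toPunishmentData.plays G, G.IsConsistent lam ξ

variable [Fintype P] {G : MeanPayoffGame P V} {lam : V → EReal} {β : ℕ}

/-- The first vertex of the plays of the family. -/
def ConsFamily.first (F : ConsFamily G lam β) : V :=
  (F.h ++ F.c).head (List.append_ne_nil_of_right_ne_nil _ F.c_ne_nil)

/-- Player `i` may deviate from the family after the word `h'`, a prefix of `hc`, by going
to `v`. -/
def ConsFamily.IsPreDev (i : P) (F : ConsFamily G lam β) (h' : List V) (v : V) : Prop :=
  h' <+: F.h ++ F.c ∧ ∃ w ∈ h'.getLast?, G.owner w = i ∧ G.Edge w v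

/-- Player `i` may deviate from `ρ`, after the punishing cycle of the family, by going to `u`. -/
def ConsFamily.IsPostDev (i : P) (F : ConsFamily G lam β) (u : V) : Prop :=
  ∃ w ∈ F.W, G.owner w = i ∧ G.Edge w u

/-- `q` leads inside `W` from the end of the punishing cycle to a vertex of player `i` that has
an edge to `u`. -/
def ConsFamily.IsPostPath (i : P) (F : ConsFamily G lam β) (u : V) (q : List V) : Prop :=
  (F.c.getLast F.c_ne_nil :: q ++ [u]).IsChain G.Edge ∧ (∀ w ∈ q, w ∈ F.W) ∧
    ∃ w ∈ q.getLast?, G.owner w = i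

end Families

section Reduced

variable {P V : Type*} [Fintype P]

/-- The arbitrary choices in the interpretation of a play of the reduced negotiation game:
a representative `ρ` of each family, and, for each post-cycle deviation (and possibly depending
on the history `g` of `G` constructed so far), one of the shortest connecting histories. -/
structure Choices (G : MeanPayoffGame P V) (lam : V → EReal) (i : P) (β : ℕ) where
  tail : ConsFamily G lam β → ℕ → V
  tail_spec : ∀ F : ConsFamily G lam β, F.IsTail G (tail F)
  path : List V → ConsFamily G lam β → V → List V
  path_spec : ∀ (g : List V) (F : ConsFamily G lam β) (u : V), F.IsPostDev i u → F.IsPostPath i u (path g F u)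
  path_shortest : ∀ (g : List V) (F : ConsFamily G lam β) (u : V), F.IsPostDev i u →
    ∀ q, F.IsPostPath i u q → (path g F u).length ≤ q.length

/-- Such choices always exist. -/
theorem Choices.nonempty (G : MeanPayoffGame P V) (lam : V → EReal) (i : P) (β : ℕ) :
    Nonempty (Choices G lam i β) := by
  classical
  have key : ∀ (F : ConsFamily G lam β) (u : V), ∃ q, F.IsPostDev i u →
      F.IsPostPath i u q ∧ ∀ q', F.IsPostPath i u q' → q.length ≤ q'.length := by
    intro F u
    by_cases hd : F.IsPostDev i u
    swap
    · exact ⟨[], fun h => absurd h hd⟩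
    have hex : ∃ q, F.IsPostPath i u q := by
      obtain ⟨w, hwW, hwi, hwu⟩ := hd
      obtain ⟨ρ, hplay, -, hocc⟩ := F.exists_tail
      rw [← hocc] at hwW
      obtain ⟨m, rfl⟩ := hwW
      have hlen : 0 < F.c.length := List.length_pos_iff.mpr F.c_ne_nil
      have hρ : ∀ n, G.Edge (ρ n) (ρ (n + 1)) := by
        intro n
        have := hplay ((F.h ++ F.c).length + n)
        unfold appendPlay at this
        rw [dif_neg (by omega), dif_neg (by omega)] at this
        convert this using 2 <;> omega
      have h0 : G.Edge (F.c.getLast F.c_ne_nil) (ρ 0) := by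
        have := hplay ((F.h ++ F.c).length - 1)
        unfold appendPlay at this
        rw [dif_pos (by simp; omega), dif_neg (by simp; omega)] at this
        rw [← List.getLast_eq_getElem (List.append_ne_nil_of_right_ne_nil _ F.c_ne_nil),
          List.getLast_append_of_ne_nil _ F.c_ne_nil] at this
        convert this using 2
        simp
        omega
      have hchain : ∀ m, ((List.range (m + 1)).map ρ).IsChain G.Edge := by
        intro m
        rw [List.isChain_iff_getElem]
        intro k hk
        simpa using hρ k
      refine ⟨(List.range (m + 1)).map ρ, ?_, ?_, ρ m, ?_, hwi⟩
      · rw [List.isChain_append]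
        refine ⟨?_, by simp, ?_⟩
        · rw [List.isChain_cons]
          refine ⟨?_, hchain m⟩
          intro y hy
          simp [List.range_succ_eq_map] at hy
          exact hy ▸ h0
        · intro x hx y hy
          simp [List.range_succ, List.getLast?_cons] at hx hy
          subst hx hy
          exact hwu
      · intro w hw
        rw [← hocc]
        simp only [List.mem_map] at hw
        obtain ⟨k, -, rfl⟩ := hw
        exact ⟨k, rfl⟩
      · simp [List.range_succ]
    obtain ⟨q, hq, hmin⟩ := WellFounded.has_min (measure (List.length (α := V))).wf
      {q | F.IsPostPath i u q} hex
    exact ⟨q, fun _ => ⟨hq, fun q' hq' => not_lt.mp (hmin q' hq')⟩⟩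
  choose q hq using key
  exact ⟨⟨fun F => F.exists_tail.choose, fun F => F.exists_tail.choose_spec,
    fun _ F u => q F u, fun _ F u hd => (hq F u hd).1, fun _ F u hd => (hq F u hd).2⟩⟩

/-- The states of the reduced negotiation game: `v`, `[h c^∞ ρ]`, `[h'v]`, `(c, u)`, `⊤`, `⊥`. -/
inductive RedState (G : MeanPayoffGame P V) (lam : V → EReal) (i : P) (β : ℕ) where
  | vertex (v : V)
  | proposal (F : ConsFamily G lam β)
  | pre (h' : List V) (v : V) (hp : ∃ F : ConsFamily G lam β, F.IsPreDev i h' v)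
  | post (c : List V) (u : V) (hp : ∃ F : ConsFamily G lam β, F.c = c ∧ F.IsPostDev i u)
  | top
  | bot

variable {G : MeanPayoffGame P V} {lam : V → EReal} {i : P} {β : ℕ}

/-- The transitions of the reduced negotiation game. -/
inductive RedEdge : RedState G lam i β → RedState G lam i β → Prop where
  | propose (v : V) (F : ConsFamily G lam β) (hF : F.first = v) :
      RedEdge (.vertex v) (.proposal F)
  | giveUp (v : V) : RedEdge (.vertex v) .bot
  | accept (F : ConsFamily G lam β) : RedEdge (.proposal F) .top
  | preDev (F : ConsFamily G lam β) (h' : List V) (v : V) (hd : F.IsPreDev i h' v) :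
      RedEdge (.proposal F) (.pre h' v ⟨F, hd⟩)
  | postDev (F : ConsFamily G lam β) (u : V) (hd : F.IsPostDev i u) :
      RedEdge (.proposal F) (.post F.c u ⟨F, rfl, hd⟩)
  | preBack (h' : List V) (v : V) (hp : ∃ F : ConsFamily G lam β, F.IsPreDev i h' v) :
      RedEdge (.pre h' v hp) (.vertex v)
  | postBack (c : List V) (u : V)
      (hp : ∃ F : ConsFamily G lam β, F.c = c ∧ F.IsPostDev i u) :
      RedEdge (.post c u hp) (.vertex u)
  | topLoop : RedEdge .top .top
  | botLoop : RedEdge .bot .bot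

/-- Prover controls the vertices of `G`, Challenger all the other states. -/
def RedState.role : RedState G lam i β → Role
  | .vertex _ => .prover
  | _ => .challenger

/-- `h` followed by the punishing cycle, repeated quadratically often, when the family is
proposed after the history `g` of `G`. -/
def ConsFamily.punish (g : List V) (F : ConsFamily G lam β) : List V :=
  F.h ++ wordPow F.c ((g ++ F.h).length ^ 2)

/-- The word that a transition appends to the history `g` of `G` constructed so far (for
transitions other than the acceptance of a proposal). -/
def dotPiece (ch : Choices G lam i β) (g : List V) :
    RedState G lam i β → RedState G lam i β → List V
  | .proposal _, .pre h' _ _ => h'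
  | .proposal F, .post _ u _ => F.punish g ++ ch.path g F u
  | _, _ => []

/-- The history of `G` constructed along the first `n` transitions of `π`. -/
def dotHist (ch : Choices G lam i β) (π : ℕ → RedState G lam i β) : ℕ → List V
  | 0 => []
  | n + 1 => dotHist ch π n ++ dotPiece ch (dotHist ch π n) (π n) (π (n + 1))

open Classical in
/-- The play of `G` constructed along a play `π` that does not reach `⊥`; `d` is a dummy vertex. -/
noncomputable def dotPlay (ch : Choices G lam i β) (d : V) (π : ℕ → RedState G lam i β) : ℕ → V :=
  if h : ∃ nF : ℕ × ConsFamily G lam β, π nF.1 = .proposal nF.2 ∧ π (nF.1 + 1) = .top then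
    appendPlay (dotHist ch π h.choose.1 ++ h.choose.2.punish (dotHist ch π h.choose.1))
      (ch.tail h.choose.2)
  else limitWord d (dotHist ch π)

open Classical in
/-- Challenger's payoff. -/
noncomputable def challengerPayoff (ch : Choices G lam i β) (d : V)
    (π : ℕ → RedState G lam i β) : EReal :=
  if ∃ n, π n = .bot then ⊤ else (G.mu i (dotPlay ch d π) : EReal)

/-- The reduced negotiation game, to be initialized at the state `vertex v₀`. -/
noncomputable def reducedGame (G : MeanPayoffGame P V) (lam : V → EReal) (i : P) (β : ℕ)
    (ch : Choices G lam i β) (v₀ : V) : Game Role (RedState G lam i β) where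
  owner := RedState.role
  Edge := RedEdge
  exists_edge
    | .vertex v => ⟨_, .giveUp v⟩
    | .proposal F => ⟨_, .accept F⟩
    | .pre h' v hp => ⟨_, .preBack h' v hp⟩
    | .post c u hp => ⟨_, .postBack c u hp⟩
    | .top => ⟨_, .topLoop⟩
    | .bot => ⟨_, .botLoop⟩
  payoff
    | .challenger => challengerPayoff ch v₀
    | .prover => fun π => -challengerPayoff ch v₀ π

end Reduced

/-! The state space of the reduced game is finite, so Prover has finitely many positional strategies
and a best one exists. It is optimal as soon as, for all real `α` and `ε > 0`, either a positional
strategy of Prover keeps Challenger's payoff at most `α + ε`, or a positional strategy of Challenger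
keeps it at least `α` (`positional_determinacy`).

The payoff is not a mean payoff over transitions, because a punishing cycle is repeated `|gh|²`
times. Subtract `α` from the rewards; then the sign of the cycle's weight is what matters. If cycles
of nonpositive weight are crossed infinitely often, the averages taken right after their repetitions
have limit inferior at most `α`, so Prover is satisfied. If only positive cycles are crossed from
some point on, each crossing eventually gains more than any fixed constant. So a crossing may be
given a constant weight, `-L` or `K`, with `K` large compared to the other transitions and `L` large
compared to `K` (`redWeight`). Accepting a family is settled by comparing its payoff with `α`
(`ThresholdEdge`). This leaves an ordinary finite mean-payoff game.

`exists_potential` solves that game up to `ε`: there are a region `W` and a potential `φ` such that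
Prover can keep weight plus increase of `φ` below `ε` inside `W`, and Challenger can keep it
positive outside. Along a play, `exists_not_frequently_drop` shows that crossings which change the
potential too much occur only finitely often. The remaining inequalities telescope into bounds on
the mean payoff of the constructed play (`IsEndless.mu_le`, `IsEndless.le_mu`). -/

/-! ### Discounted games and potentials for mean-payoff games. -/

theorem Finset.inf'_le_inf'_add {ι : Type*} {s : Finset ι} (hs : s.Nonempty) {f g : ι → ℝ} {c : ℝ}
    (h : ∀ t ∈ s, f t ≤ g t + c) : s.inf' hs f ≤ s.inf' hs g + c := by
  obtain ⟨t, ht, hgt⟩ := s.exists_mem_eq_inf' hs g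
  rw [hgt]
  exact (Finset.inf'_le f ht).trans (h t ht)

theorem Finset.sup'_le_sup'_add {ι : Type*} {s : Finset ι} (hs : s.Nonempty) {f g : ι → ℝ} {c : ℝ}
    (h : ∀ t ∈ s, f t ≤ g t + c) : s.sup' hs f ≤ s.sup' hs g + c := by
  obtain ⟨t, ht, hft⟩ := s.exists_mem_eq_sup' hs f
  rw [hft]
  exact (h t ht).trans (by gcongr; exact Finset.le_sup' g ht)

/-- Values of a finite discounted game. -/
theorem exists_discounted_values {S : Type*} [Finite S] (E : S → S → Prop)
    (hE : ∀ s, ∃ t, E s t) (isMin : S → Prop) (w : S → S → ℝ) {γ : ℝ} (h0 : 0 ≤ γ) (h1 : γ < 1) :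
    ∃ v : S → ℝ,
      (∀ s, isMin s → (∃ t, E s t ∧ v s = w s t + γ * v t) ∧ ∀ t, E s t → v s ≤ w s t + γ * v t) ∧
      (∀ s, ¬ isMin s →
        (∃ t, E s t ∧ v s = w s t + γ * v t) ∧ ∀ t, E s t → w s t + γ * v t ≤ v s) := by
  classical
  have := Fintype.ofFinite S
  let succs : S → Finset S := fun s => Finset.univ.filter (E s)
  have hs : ∀ s, (succs s).Nonempty := fun s => by
    obtain ⟨t, ht⟩ := hE s
    exact ⟨t, by simp [succs, ht]⟩
  -- Bellman operator, a `γ`-contraction for the sup distance; its fixed point is the vector of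
  -- values.
  let T : (S → ℝ) → (S → ℝ) := fun v s =>
    if isMin s then (succs s).inf' (hs s) (fun t => w s t + γ * v t)
    else (succs s).sup' (hs s) (fun t => w s t + γ * v t)
  have hT : ∀ u v : S → ℝ, ∀ s, T u s ≤ T v s + γ * dist u v := by
    intro u v s
    have key : ∀ t ∈ succs s, w s t + γ * u t ≤ w s t + γ * v t + γ * dist u v := by
      intro t _
      have h2 : u t - v t ≤ dist u v :=
        (le_abs_self _).trans ((Real.dist_eq _ _).symm.le.trans (dist_le_pi_dist u v t))
      nlinarith
    by_cases hm : isMin s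
    · simp only [T, if_pos hm]
      exact Finset.inf'_le_inf'_add (hs s) key
    · simp only [T, if_neg hm]
      exact Finset.sup'_le_sup'_add (hs s) key
  have hc : ContractingWith ⟨γ, h0⟩ T := by
    refine ⟨by exact_mod_cast h1, LipschitzWith.of_dist_le_mul fun u v => ?_⟩
    refine (dist_pi_le_iff (mul_nonneg h0 dist_nonneg)).2 fun s => ?_
    rw [Real.dist_eq, abs_le]
    have a := hT u v s
    have b := hT v u s
    rw [dist_comm v u] at b
    change -(γ * _) ≤ _ ∧ _ ≤ γ * _
    constructor <;> linarith
  have : Nonempty (S → ℝ) := ⟨fun _ => 0⟩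
  obtain ⟨v, hv⟩ : ∃ v, T v = v := ⟨_, hc.fixedPoint_isFixedPt⟩
  refine ⟨v, fun s hm => ?_, fun s hm => ?_⟩
  · have hvs : (succs s).inf' (hs s) (fun t => w s t + γ * v t) = v s := by
      rw [← congrFun hv s]; simp only [T, if_pos hm]
    constructor
    · obtain ⟨t, ht, he⟩ := (succs s).exists_mem_eq_inf' (hs s) (fun t => w s t + γ * v t)
      exact ⟨t, by simpa [succs] using ht, by rw [← hvs, he]⟩
    · intro t ht
      rw [← hvs]
      exact Finset.inf'_le _ (by simp [succs, ht])
  · have hvs : (succs s).sup' (hs s) (fun t => w s t + γ * v t) = v s := by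
      rw [← congrFun hv s]; simp only [T, if_neg hm]
    constructor
    · obtain ⟨t, ht, he⟩ := (succs s).exists_mem_eq_sup' (hs s) (fun t => w s t + γ * v t)
      exact ⟨t, by simpa [succs] using ht, by rw [← hvs, he]⟩
    · intro t ht
      rw [← hvs]
      exact Finset.le_sup' (fun t => w s t + γ * v t) (by simp [succs, ht])

/-- Finitely many reals leave a gap around some point of any interval `(0, ε)`. -/
theorem exists_gap {S : Type*} [Finite S] {ε : ℝ} (hε : 0 < ε) :
    ∃ η > 0, ∀ a : S → ℝ, ∃ θ, 0 < θ ∧ θ < ε ∧ ∀ s, η < |a s - θ| := by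
  have := Fintype.ofFinite S
  set n : ℕ := Fintype.card S with hn
  have hpos : (0 : ℝ) < n + 2 := by positivity
  have hη : 0 < ε / (n + 2) := by positivity
  refine ⟨ε / (n + 2) / 3, by positivity, fun a => ?_⟩
  by_contra! hcon
  -- The candidates for `θ` are `n + 1` points spaced by `ε / (n + 2)`. If all failed, two of them
  -- would lie within a third of the spacing of the same value.
  have hb : ∀ j : Fin (n + 1), ∃ s, |a s - (j + 1) * (ε / (n + 2))| ≤ ε / (n + 2) / 3 := by
    intro j
    apply hcon
    · positivity
    · have hj : ((j : ℕ) : ℝ) + 1 < n + 2 := by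
        have := j.2
        have h2 : ((j : ℕ) : ℝ) < n + 1 := by exact_mod_cast this
        linarith
      calc ((j : ℕ) + 1) * (ε / (n + 2)) < (n + 2) * (ε / (n + 2)) := by gcongr
        _ = ε := by field_simp
  choose f hf using hb
  obtain ⟨j, k, hjk, hfe⟩ := Fintype.exists_ne_map_eq_of_card_lt f (by simp [hn])
  have h1 := abs_le.1 (hf j)
  have h2 := abs_le.1 (hf k)
  rw [hfe] at h1
  rcases lt_or_gt_of_ne hjk with h | h
  · have h3 : ((j : ℕ) : ℝ) + 1 ≤ (k : ℕ) := by exact_mod_cast h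
    nlinarith [h1.1, h1.2, h2.1, h2.2]
  · have h3 : ((k : ℕ) : ℝ) + 1 ≤ (j : ℕ) := by exact_mod_cast h
    nlinarith [h1.1, h1.2, h2.1, h2.2]

/-- Positional determinacy of finite mean-payoff games, up to `ε`, in terms of a potential. -/
theorem exists_potential {S : Type*} [Finite S] (E : S → S → Prop)
    (hE : ∀ s, ∃ t, E s t) (isMin : S → Prop) (w : S → S → ℝ) {ε : ℝ} (hε : 0 < ε) :
    ∃ (W : Set S) (φ : S → ℝ),
      (∀ s ∈ W, isMin s → ∃ t ∈ W, E s t ∧ w s t + φ t < φ s + ε) ∧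
      (∀ s ∈ W, ¬ isMin s → ∀ t, E s t → t ∈ W ∧ w s t + φ t < φ s + ε) ∧
      (∀ s ∉ W, ¬ isMin s → ∃ t ∉ W, E s t ∧ φ s < w s t + φ t) ∧
      (∀ s ∉ W, isMin s → ∀ t, E s t → t ∉ W ∧ φ s < w s t + φ t) := by
  classical
  obtain ⟨M, hM0, hM⟩ : ∃ M : ℝ, 0 < M ∧ ∀ s t, |w s t| ≤ M := by
    obtain ⟨M, hM⟩ := Finite.bddAbove_range (fun p : S × S => |w p.1 p.2|)
    exact ⟨max M 1, by positivity, fun s t => le_max_of_le_left (hM ⟨(s, t), rfl⟩)⟩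
  obtain ⟨η, hη, hgap⟩ := exists_gap (S := S) hε
  -- Here `d` is one minus the discount factor. Since `|w|` and `|d * v|` are at most `M`, the
  -- Bellman inequalities limit the crossing of a threshold by `d * v` to `2 * M * d ≤ η`, so the
  -- gap around `θ` cannot be jumped.
  obtain ⟨d, hd0, hd1, hdη⟩ : ∃ d : ℝ, 0 < d ∧ d < 1 ∧ 2 * M * d ≤ η := by
    refine ⟨min (1 / 2) (η / (2 * M)), by positivity, (min_le_left _ _).trans_lt (by norm_num), ?_⟩
    calc 2 * M * min (1 / 2) (η / (2 * M)) ≤ 2 * M * (η / (2 * M)) := by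
          gcongr; exact min_le_right _ _
      _ = η := by field_simp
  obtain ⟨v, hmin, hmax⟩ := exists_discounted_values E hE isMin w (γ := 1 - d)
    (by linarith) (by linarith)
  have hv : ∀ s, |d * v s| ≤ M := by
    intro s
    have : Nonempty S := ⟨s⟩
    obtain ⟨m, hm⟩ := Finite.exists_max fun s => |v s|
    have hvm : |v m| ≤ M + (1 - d) * |v m| := by
      obtain ⟨t, -, ht⟩ : ∃ t, E m t ∧ v m = w m t + (1 - d) * v t := by
        by_cases h : isMin m
        · exact (hmin m h).1
        · exact (hmax m h).1
      calc |v m| ≤ |w m t| + |(1 - d) * v t| := by rw [ht]; exact abs_add_le _ _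
        _ = |w m t| + (1 - d) * |v t| := by rw [abs_mul, abs_of_nonneg (by linarith : 0 ≤ 1 - d)]
        _ ≤ M + (1 - d) * |v m| := by
          have := hM m t
          have := hm t
          have : (1 - d) * |v t| ≤ (1 - d) * |v m| :=
            mul_le_mul_of_nonneg_left this (by linarith)
          linarith
    rw [abs_mul, abs_of_pos hd0]
    have := mul_le_mul_of_nonneg_left (hm s) hd0.le
    linarith
  obtain ⟨θ, hθ0, hθε, hθ⟩ := hgap fun s => d * v s
  -- The Bellman inequality reads `w s t + v t - v s ≤ d * v t`: the quantity that delimits the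
  -- region also bounds the excess, so `0 < θ < ε` serves both purposes.
  have hlow : ∀ s t, d * v s < θ → w s t + (1 - d) * v t ≤ v s →
      d * v t < θ ∧ w s t + v t < v s + ε := by
    intro s t hs hst
    have h1 := hθ s
    rw [abs_of_neg (by linarith)] at h1
    have h2 := abs_le.1 (hM s t)
    have h3 := abs_le.1 (hv t)
    have h4 : d * v t < θ := by nlinarith
    exact ⟨h4, by linarith⟩
  have hhigh : ∀ s t, ¬ d * v s < θ → v s ≤ w s t + (1 - d) * v t →
      ¬ d * v t < θ ∧ v s < w s t + v t := by
    intro s t hs hst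
    have h1 := hθ s
    rw [abs_of_nonneg (by linarith)] at h1
    have h2 := abs_le.1 (hM s t)
    have h3 := abs_le.1 (hv t)
    have h4 : θ ≤ d * v t := by nlinarith
    exact ⟨not_lt.2 h4, by linarith⟩
  refine ⟨{s | d * v s < θ}, v, ?_, ?_, ?_, ?_⟩
  · intro s hs hm
    obtain ⟨⟨t, ht, he⟩, -⟩ := hmin s hm
    exact ⟨t, (hlow s t hs he.ge).1, ht, (hlow s t hs he.ge).2⟩
  · intro s hs hm t ht
    exact hlow s t hs ((hmax s hm).2 t ht)
  · intro s hs hm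
    obtain ⟨⟨t, ht, he⟩, -⟩ := hmax s hm
    exact ⟨t, (hhigh s t hs he.le).1, ht, (hhigh s t hs he.le).2⟩
  · intro s hs hm t ht
    exact hhigh s t hs ((hmin s hm).2 t ht)

/-! ### Paths and drops of a potential. -/

/-- In a finite type, related points are joined by paths of bounded length. -/
theorem exists_path_length_bound (S : Type*) [Finite S] :
    ∃ N : ℕ, ∀ (R : S → S → Prop) (a b : S), Relation.ReflTransGen R a b →
      ∃ n ≤ N, ∃ f : ℕ → S, f 0 = a ∧ f n = b ∧ ∀ k < n, R (f k) (f (k + 1)) := by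
  -- There are finitely many triples of a relation and two points, so the bound can be uniform in
  -- the relation, which will depend on a potential not yet known.
  have key : ∀ x : (S → S → Prop) × S × S, ∃ n : ℕ, Relation.ReflTransGen x.1 x.2.1 x.2.2 →
      ∃ f : ℕ → S, f 0 = x.2.1 ∧ f n = x.2.2 ∧ ∀ k < n, x.1 (f k) (f (k + 1)) := by
    rintro ⟨R, a, b⟩
    by_cases h : Relation.ReflTransGen R a b
    swap
    · exact ⟨0, fun h' => absurd h' h⟩
    suffices ∃ n : ℕ, ∃ f : ℕ → S, f 0 = a ∧ f n = b ∧ ∀ k < n, R (f k) (f (k + 1)) by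
      obtain ⟨n, hn⟩ := this
      exact ⟨n, fun _ => hn⟩
    induction h with
    | refl => exact ⟨0, fun _ => a, rfl, rfl, by simp⟩
    | @tail b c _ hbc ih =>
      obtain ⟨n, f, h0, hn, hf⟩ := ih
      refine ⟨n + 1, fun k => if k ≤ n then f k else c, by simp [h0], by simp, fun k hk => ?_⟩
      rcases Nat.lt_succ_iff_lt_or_eq.1 hk with h | rfl
      · simpa [h.le, Nat.succ_le_iff.2 h] using hf k h
      · simpa [hn] using hbc
  choose len hlen using key
  obtain ⟨N, hN⟩ := Finite.bddAbove_range len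
  exact ⟨N, fun R a b h => ⟨len (R, a, b), hN ⟨_, rfl⟩, hlen (R, a, b) h⟩⟩

/-- A potential that grows by at most `D` at each step cannot drop by more than `N * D` in one
step infinitely often, for some `N` that depends only on the finite state space. -/
theorem exists_not_frequently_drop (S : Type*) [Finite S] :
    ∃ N : ℕ, ∀ (φ : S → ℝ) (D : ℝ) (π : ℕ → S), 0 ≤ D →
      (∀ᶠ n in atTop, φ (π (n + 1)) ≤ φ (π n) + D) →
      ¬ ∃ᶠ n in atTop, φ (π (n + 1)) + N * D < φ (π n) := by
  obtain ⟨N, hN⟩ := exists_path_length_bound S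
  refine ⟨N, fun φ D π hD hstep hdrop => ?_⟩
  obtain ⟨n₀, hn₀⟩ := eventually_atTop.1 hstep
  have hinf : {n | n₀ ≤ n ∧ φ (π (n + 1)) + N * D < φ (π n)}.Infinite := by
    rw [← Nat.frequently_atTop_iff_infinite]
    exact ((eventually_ge_atTop n₀).and_frequently hdrop)
  -- Two drops occur at the same state. The path from just after the first one back to that state
  -- can be shortened to at most `N` steps, which climb too little to undo the drop.
  obtain ⟨n, hn, m, hm, hnm, he⟩ := hinf.exists_lt_map_eq_of_mapsTo (f := π)
    (t := Set.univ) (fun _ _ => Set.mem_univ _) Set.finite_univ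
  have hreach : ∀ k, Relation.ReflTransGen (fun s t => φ t ≤ φ s + D) (π (n + 1)) (π (n + 1 + k)) := by
    intro k
    induction k with
    | zero => exact .refl
    | succ k ih =>
      have hk : n₀ ≤ n + 1 + k := by have := hn.1; omega
      exact ih.tail (hn₀ _ hk)
  obtain ⟨l, hl, f, h0, hfl, hf⟩ := hN _ _ _ (hreach (m - (n + 1)))
  have hsum : ∀ k ≤ l, φ (f k) ≤ φ (f 0) + k * D := by
    intro k
    induction k with
    | zero => simp
    | succ k ih =>
      intro hk
      have := ih (by omega)
      have := hf k (by omega)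
      push_cast
      linarith
  have h1 := hsum l le_rfl
  rw [h0, hfl, show n + 1 + (m - (n + 1)) = m by omega, ← he] at h1
  have h2 : (l : ℝ) * D ≤ N * D := by gcongr
  have := hn.2
  linarith

/-! ### Weights of finite words. -/

section WordSums

variable {V : Type*}

/-- The sum of the weights of the consecutive pairs of a word. -/
def wordSum (R : V → V → ℝ) : List V → ℝ
  | [] => 0
  | [_] => 0
  | a :: b :: l => R a b + wordSum R (b :: l)

variable {R : V → V → ℝ} {M : ℝ}

theorem wordSum_append_cons (l : List V) (a : V) (l' : List V) :
    wordSum R (l ++ a :: l') = wordSum R (l ++ [a]) + wordSum R (a :: l') := by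
  induction l with
  | nil => simp [wordSum]
  | cons b l ih =>
    cases l with
    | nil => simp [wordSum]
    | cons c l =>
      simp only [List.cons_append, wordSum] at ih ⊢
      rw [ih]; ring

theorem abs_wordSum_append_singleton (hM : ∀ a b, |R a b| ≤ M) (hM0 : 0 ≤ M) (l : List V) (a : V) :
    |wordSum R (l ++ [a]) - wordSum R l| ≤ M := by
  induction l with
  | nil => simpa [wordSum] using hM0
  | cons b l ih =>
    cases l with
    | nil => simpa [wordSum] using hM b a
    | cons c l => simpa only [List.cons_append, wordSum, add_sub_add_left_eq_sub] using ih

theorem abs_wordSum_append (hM : ∀ a b, |R a b| ≤ M) (hM0 : 0 ≤ M) (l l' : List V) :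
    |wordSum R (l ++ l') - wordSum R l - wordSum R l'| ≤ M := by
  cases l' with
  | nil => simpa [wordSum] using hM0
  | cons a l' =>
    rw [wordSum_append_cons]
    convert abs_wordSum_append_singleton hM hM0 l a using 2
    ring

theorem abs_wordSum_le (hM : ∀ a b, |R a b| ≤ M) (hM0 : 0 ≤ M) (l : List V) :
    |wordSum R l| ≤ M * l.length := by
  induction l with
  | nil => simp [wordSum]
  | cons b l ih =>
    cases l with
    | nil => simpa [wordSum] using hM0
    | cons c l =>
      have h1 := abs_add_le (R b c) (wordSum R (c :: l))
      have h2 := hM b c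
      simp only [wordSum]
      push_cast [List.length_cons] at ih ⊢
      linarith

theorem wordPow_succ (c : List V) (n : ℕ) : wordPow c (n + 1) = c ++ wordPow c n := by
  simp [wordPow, List.replicate_succ]

theorem length_wordPow (c : List V) (n : ℕ) : (wordPow c n).length = n * c.length := by
  simp [wordPow]

theorem wordSum_wordPow (c : List V) (hc : c ≠ []) (n : ℕ) :
    wordSum R (wordPow c n ++ [c.head hc]) = n * wordSum R (c ++ [c.head hc]) := by
  induction n with
  | zero => simp [wordPow, wordSum]
  | succ n ih =>
    have h : wordPow c n ++ [c.head hc] = c.head hc :: (wordPow c n ++ [c.head hc]).tail := by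
      cases n with
      | zero => simp [wordPow]
      | succ n =>
        obtain ⟨a, c, rfl⟩ := List.exists_cons_of_ne_nil hc
        simp [wordPow_succ]
    rw [wordPow_succ, List.append_assoc, h, wordSum_append_cons, ← h, ih]
    push_cast
    ring

/-- Full turns around a cycle of nonnegative weight lose nothing; only the last, incomplete turn
can. -/
theorem le_wordSum_take_wordPow (hM : ∀ a b, |R a b| ≤ M) (hM0 : 0 ≤ M) (c : List V) (hc : c ≠ [])
    (hpos : 0 ≤ wordSum R (c ++ [c.head hc])) (n j : ℕ) :
    -(M * c.length) ≤ wordSum R ((wordPow c n).take j) := by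
  have hshort : ∀ l : List V, l.length ≤ c.length → -(M * c.length) ≤ wordSum R l := by
    intro l hl
    have h1 := (abs_le.1 (abs_wordSum_le hM hM0 l)).1
    have h2 : M * l.length ≤ M * c.length := by gcongr
    linarith
  induction n generalizing j with
  | zero => exact hshort _ (by simp [wordPow])
  | succ n ih =>
    rcases le_or_gt j c.length with hj | hj
    · exact hshort _ (by simp [hj])
    · obtain ⟨k, rfl⟩ : ∃ k, j = c.length + (k + 1) := ⟨j - c.length - 1, by omega⟩
      rw [wordPow_succ, List.take_length_add_append]
      cases n with
      | zero => exact hshort _ (by simp [wordPow])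
      | succ n =>
        have h : (wordPow c (n + 1)).take (k + 1) =
            c.head hc :: ((wordPow c (n + 1)).take (k + 1)).tail := by
          obtain ⟨a, c, rfl⟩ := List.exists_cons_of_ne_nil hc
          simp [wordPow_succ]
        rw [h, wordSum_append_cons, ← h]
        have := ih (k + 1)
        linarith

theorem wordSum_eq_sum (ρ : ℕ → V) (l : List V)
    (h : ∀ k (hk : k < l.length), ρ k = l[k]) :
    wordSum R l = ∑ k ∈ Finset.range (l.length - 1), R (ρ k) (ρ (k + 1)) := by
  induction l generalizing ρ with
  | nil => simp [wordSum]
  | cons a l ih =>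
    cases l with
    | nil => simp [wordSum]
    | cons b l =>
      have h0 := h 0 (by simp)
      have h1 := h 1 (by simp)
      simp only [List.length_cons, Nat.add_sub_cancel, wordSum] at ih ⊢
      rw [Finset.sum_range_succ', ih (fun k => ρ (k + 1)) fun k hk => by
        exact h (k + 1) (by simpa using hk)]
      simp at h0 h1
      rw [h0, h1]
      ring

/-- The sum over `l.length` indices has one extra term, for the pair leaving the last letter of `l`.
-/
theorem abs_sum_sub_wordSum_le (hM : ∀ a b, |R a b| ≤ M) (hM0 : 0 ≤ M) (ρ : ℕ → V) (l : List V)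
    (h : ∀ k (hk : k < l.length), ρ k = l[k]) :
    |∑ k ∈ Finset.range l.length, R (ρ k) (ρ (k + 1)) - wordSum R l| ≤ M := by
  rw [wordSum_eq_sum ρ l h]
  rcases Nat.eq_zero_or_pos l.length with h0 | h0
  · simpa [h0] using hM0
  · obtain ⟨k, hk⟩ : ∃ k, l.length = k + 1 := ⟨l.length - 1, by omega⟩
    rw [hk, Finset.sum_range_succ]
    simpa using hM _ _

theorem limitWord_eq (d : V) (L : ℕ → List V) (hL : ∀ n, L n <+: L (n + 1)) (n k : ℕ)
    (hk : k < (L n).length) : limitWord d L k = (L n)[k] := by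
  classical
  have hmono : ∀ m n, m ≤ n → L m <+: L n := by
    intro m n hmn
    induction hmn with
    | refl => exact List.prefix_rfl
    | step _ ih => exact ih.trans (hL _)
  have hex : ∃ n, k < (L n).length := ⟨n, hk⟩
  rw [limitWord, dif_pos hex]
  exact (hmono _ _ (Nat.find_min' hex hk)).getElem _

end WordSums

/-! ### Mean payoffs through partial sums. -/

namespace MeanPayoffGame

theorem sum_reward_sub {P V : Type*} (G : MeanPayoffGame P V) (p : P) (ρ : ℕ → V) (a : ℝ) (n : ℕ) :
    ∑ k ∈ Finset.range n, ((G.reward p (ρ k) (ρ (k + 1)) : ℝ) - a) =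
      (∑ k ∈ Finset.range n, (G.reward p (ρ k) (ρ (k + 1)) : ℝ)) - n * a := by
  simp [Finset.sum_sub_distrib]

variable {P V : Type*} [Finite V] (G : MeanPayoffGame P V) (p : P)

theorem exists_reward_bound : ∃ M : ℝ, 0 ≤ M ∧ ∀ a b, |(G.reward p a b : ℝ)| ≤ M := by
  obtain ⟨M, hM⟩ := Finite.bddAbove_range (fun x : V × V => |(G.reward p x.1 x.2 : ℝ)|)
  exact ⟨max M 0, le_max_right _ _, fun a b => le_max_of_le_left (hM ⟨(a, b), rfl⟩)⟩

theorem exists_average_bound (ρ : ℕ → V) : ∃ M : ℝ, ∀ n : ℕ,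
    |(∑ k ∈ Finset.range n, (G.reward p (ρ k) (ρ (k + 1)) : ℝ)) / (n : ℝ)| ≤ M := by
  obtain ⟨M, hM0, hM⟩ := G.exists_reward_bound p
  refine ⟨M, fun n => ?_⟩
  rw [abs_div, Nat.abs_cast]
  refine div_le_of_le_mul₀ n.cast_nonneg hM0 ?_
  calc _ ≤ ∑ k ∈ Finset.range n, |(G.reward p (ρ k) (ρ (k + 1)) : ℝ)| :=
        Finset.abs_sum_le_sum_abs _ _
    _ ≤ ∑ _k ∈ Finset.range n, M := Finset.sum_le_sum fun _ _ => hM _ _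
    _ = M * n := by simp [mul_comm]

theorem isBoundedUnder_average (ρ : ℕ → V) : atTop.IsBoundedUnder (· ≥ ·) fun n : ℕ =>
    (∑ k ∈ Finset.range n, (G.reward p (ρ k) (ρ (k + 1)) : ℝ)) / (n : ℝ) := by
  obtain ⟨M, hM⟩ := G.exists_average_bound p ρ
  exact isBoundedUnder_of ⟨-M, fun n => (abs_le.1 (hM n)).1⟩

theorem isCoboundedUnder_average (ρ : ℕ → V) : atTop.IsCoboundedUnder (· ≥ ·) fun n : ℕ =>
    (∑ k ∈ Finset.range n, (G.reward p (ρ k) (ρ (k + 1)) : ℝ)) / (n : ℝ) := by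
  obtain ⟨M, hM⟩ := G.exists_average_bound p ρ
  exact IsBoundedUnder.isCoboundedUnder_ge (isBoundedUnder_of ⟨M, fun n => (abs_le.1 (hM n)).2⟩)

/-- Removes the division, so that bounds on partial sums of shifted rewards apply directly. -/
theorem mu_le_iff (ρ : ℕ → V) (a : ℝ) : G.mu p ρ ≤ a ↔ ∀ ε > 0, ∃ᶠ n : ℕ in atTop,
    ∑ k ∈ Finset.range n, ((G.reward p (ρ k) (ρ (k + 1)) : ℝ) - a) ≤ ε * n := by
  constructor
  · intro h ε hε
    have := frequently_lt_of_liminf_lt (G.isCoboundedUnder_average p ρ) (b := a + ε)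
      (lt_of_le_of_lt h (by linarith))
    refine (this.and_eventually (eventually_gt_atTop 0)).mono fun n hn => ?_
    have hn0 : (0 : ℝ) < n := by exact_mod_cast hn.2
    have := (div_lt_iff₀ hn0).1 hn.1
    rw [sum_reward_sub]
    linarith
  · intro h
    refine le_of_forall_pos_le_add fun ε hε => ?_
    refine liminf_le_of_frequently_le ?_ (G.isBoundedUnder_average p ρ)
    refine ((h ε hε).and_eventually (eventually_gt_atTop 0)).mono fun n hn => ?_
    have hn0 : (0 : ℝ) < n := by exact_mod_cast hn.2
    have := hn.1
    rw [sum_reward_sub] at this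
    rw [div_le_iff₀ hn0]
    linarith

theorem le_mu_iff (ρ : ℕ → V) (a : ℝ) : a ≤ G.mu p ρ ↔ ∀ ε > 0, ∀ᶠ n : ℕ in atTop,
    -(ε * n) ≤ ∑ k ∈ Finset.range n, ((G.reward p (ρ k) (ρ (k + 1)) : ℝ) - a) := by
  constructor
  · intro h ε hε
    have := eventually_lt_of_lt_liminf (b := a - ε)
      (lt_of_lt_of_le (by linarith) h) (G.isBoundedUnder_average p ρ)
    filter_upwards [this, eventually_gt_atTop 0] with n hn hn'
    have hn0 : (0 : ℝ) < n := by exact_mod_cast hn'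
    have := (lt_div_iff₀ hn0).1 hn
    rw [sum_reward_sub]
    linarith
  · intro h
    refine le_of_forall_pos_le_add fun ε hε => ?_
    rw [← sub_le_iff_le_add]
    refine le_liminf_of_le (G.isCoboundedUnder_average p ρ) ?_
    filter_upwards [h ε hε, eventually_gt_atTop 0] with n hn hn'
    have hn0 : (0 : ℝ) < n := by exact_mod_cast hn'
    rw [sum_reward_sub] at hn
    rw [le_div_iff₀ hn0]
    linarith

/-- Mean payoffs are prefix-independent. -/
theorem mu_appendPlay (l : List V) (ρ : ℕ → V) : G.mu p (appendPlay l ρ) = G.mu p ρ := by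
  have hsum : ∀ (a : ℝ) (n : ℕ), ∑ k ∈ Finset.range (l.length + n),
      ((G.reward p (appendPlay l ρ k) (appendPlay l ρ (k + 1)) : ℝ) - a) =
      ∑ k ∈ Finset.range l.length,
        ((G.reward p (appendPlay l ρ k) (appendPlay l ρ (k + 1)) : ℝ) - a) +
      ∑ k ∈ Finset.range n, ((G.reward p (ρ k) (ρ (k + 1)) : ℝ) - a) := by
    intro a n
    rw [Finset.sum_range_add]
    congr 1
    refine Finset.sum_congr rfl fun k _ => ?_
    simp only [appendPlay]
    rw [dif_neg (by omega), dif_neg (by omega), show l.length + k - l.length = k by omega,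
      show l.length + k + 1 - l.length = k + 1 by omega]
  have hlarge : ∀ C ε : ℝ, 0 < ε → ∀ᶠ n : ℕ in atTop, C ≤ ε * n := fun C ε hε =>
    (tendsto_natCast_atTop_atTop.const_mul_atTop hε).eventually_ge_atTop C
  have hshift : Tendsto (fun n => l.length + n) atTop atTop := by
    simpa only [add_comm] using tendsto_add_atTop_nat l.length
  set a := G.mu p ρ with ha
  set C := ∑ k ∈ Finset.range l.length,
    ((G.reward p (appendPlay l ρ k) (appendPlay l ρ (k + 1)) : ℝ) - a)
  refine le_antisymm ?_ ?_
  · rw [mu_le_iff]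
    intro ε hε
    refine hshift.frequently ?_
    refine (((G.mu_le_iff p ρ a).1 ha.ge (ε / 2) (by positivity)).and_eventually
      (hlarge C (ε / 2) (by positivity))).mono fun n hn => ?_
    rw [hsum]
    push_cast
    have : 0 ≤ ε * l.length := by positivity
    linarith [hn.1, hn.2]
  · rw [le_mu_iff]
    intro ε hε
    have h : ∀ᶠ n in atTop, -(ε * ((l.length + n : ℕ) : ℝ)) ≤
        ∑ k ∈ Finset.range (l.length + n),
          ((G.reward p (appendPlay l ρ k) (appendPlay l ρ (k + 1)) : ℝ) - a) := by
      filter_upwards [(G.le_mu_iff p ρ a).1 ha.le (ε / 2) (by positivity),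
        hlarge (-C) (ε / 2) (by positivity)] with n hn hn'
      rw [hsum]
      push_cast
      have : 0 ≤ ε * l.length := by positivity
      linarith
    obtain ⟨n₀, hn₀⟩ := eventually_atTop.1 h
    filter_upwards [eventually_ge_atTop (l.length + n₀)] with n hn
    have := hn₀ (n - l.length) (by omega)
    rwa [show l.length + (n - l.length) = n by omega] at this

end MeanPayoffGame

/-! ### Finiteness of the reduced game. -/

theorem finite_setOf_ratSize_le (β : ℕ) : {q : ℚ | ratSize q ≤ β}.Finite := by
  refine Set.Finite.of_finite_image (f := fun q : ℚ => (q.num, q.den))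
    (((Set.finite_Icc (-2 ^ β : ℤ) (2 ^ β)).prod (Set.finite_Iic (2 ^ β))).subset ?_) ?_
  · rintro _ ⟨q, hq, rfl⟩
    simp only [Set.mem_ofPred_eq, ratSize] at hq
    have h1 : q.num.natAbs + 1 ≤ 2 ^ β := Nat.clog_le_iff_le_pow one_lt_two |>.1 (by omega)
    have h2 : q.den + 1 ≤ 2 ^ β := Nat.clog_le_iff_le_pow one_lt_two |>.1 (by omega)
    have h3 : (q.num.natAbs : ℤ) + 1 ≤ 2 ^ β := by exact_mod_cast h1
    simp only [Set.mem_prod, Set.mem_Icc, Set.mem_Iic]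
    refine ⟨⟨?_, ?_⟩, ?_⟩ <;> omega
  · intro q _ q' _ h
    simp only [Prod.mk.injEq] at h
    exact Rat.ext h.1 h.2

section Finiteness

variable {P V : Type*} [Fintype P] [Finite V] {G : MeanPayoffGame P V} {lam : V → EReal} {i : P}
  {β : ℕ}

/-- The data determine the family and range over finite sets: simple words are no longer than the
number of vertices, and bounded size leaves finitely many rationals. -/
instance : Finite (ConsFamily G lam β) := by
  have hl : {l : List V | l.Nodup}.Finite :=
    (List.finite_length_le V (Nat.card V)).subset fun l hl => hl.length_le_natCard
  have hx : {x : P → ℚ | tupleSize x ≤ β}.Finite := by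
    refine (Set.Finite.pi' fun _ : P => finite_setOf_ratSize_le β).subset fun x hx p => ?_
    have h1 : ratSize (x p) ≤ ∑ p, ratSize (x p) :=
      Finset.single_le_sum (f := fun p => ratSize (x p)) (fun _ _ => Nat.zero_le _)
        (Finset.mem_univ p)
    have h2 : tupleSize x ≤ β := hx
    unfold tupleSize at h2
    exact h1.trans (by omega)
  refine Finite.of_finite_univ (Set.Finite.of_finite_image
    (f := fun F : ConsFamily G lam β => (F.h, F.c, F.x, F.W))
    ((hl.prod (hl.prod (hx.prod (Set.toFinite Set.univ)))).subset ?_) ?_)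
  · rintro _ ⟨F, -, rfl⟩
    exact ⟨F.h_simple, F.c_simple, F.size_le, trivial⟩
  · rintro ⟨⟨h, c, x, W⟩, _⟩ - ⟨⟨h', c', x', W'⟩, _⟩ - he
    simp only [Prod.mk.injEq] at he
    obtain ⟨rfl, rfl, rfl, rfl⟩ := he
    rfl

theorem ConsFamily.IsPreDev.length_le {F : ConsFamily G lam β} {h' : List V} {v : V}
    (h : F.IsPreDev i h' v) : h'.length ≤ Nat.card V + Nat.card V := by
  have h1 := h.1.length_le
  rw [List.length_append] at h1
  have := F.h_simple.length_le_natCard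
  have := F.c_simple.length_le_natCard
  omega

instance : Finite (RedState G lam i β) := by
  have hpre : Finite {x : List V × V // ∃ F : ConsFamily G lam β, F.IsPreDev i x.1 x.2} := by
    refine Set.Finite.subset ((List.finite_length_le V (Nat.card V + Nat.card V)).prod
      (Set.toFinite Set.univ)) ?_
    rintro x ⟨F, hF⟩
    exact ⟨hF.length_le, trivial⟩
  have hpost : Finite {x : List V × V //
      ∃ F : ConsFamily G lam β, F.c = x.1 ∧ F.IsPostDev i x.2} := by
    refine Set.Finite.subset ((List.finite_length_le V (Nat.card V)).prod
      (Set.toFinite Set.univ)) ?_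
    rintro x ⟨F, hF, -⟩
    exact ⟨hF ▸ F.c_simple.length_le_natCard, trivial⟩
  let f : V ⊕ ConsFamily G lam β ⊕
      {x : List V × V // ∃ F : ConsFamily G lam β, F.IsPreDev i x.1 x.2} ⊕
      {x : List V × V // ∃ F : ConsFamily G lam β, F.c = x.1 ∧ F.IsPostDev i x.2} ⊕ Bool →
      RedState G lam i β
    | .inl v => .vertex v
    | .inr (.inl F) => .proposal F
    | .inr (.inr (.inl x)) => .pre x.1.1 x.1.2 x.2
    | .inr (.inr (.inr (.inl x))) => .post x.1.1 x.1.2 x.2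
    | .inr (.inr (.inr (.inr true))) => .top
    | .inr (.inr (.inr (.inr false))) => .bot
  refine Finite.of_surjective f ?_
  rintro (v | F | ⟨h', v, hp⟩ | ⟨c, u, hp⟩ | _ | _)
  · exact ⟨.inl v, rfl⟩
  · exact ⟨.inr (.inl F), rfl⟩
  · exact ⟨.inr (.inr (.inl ⟨(h', v), hp⟩)), rfl⟩
  · exact ⟨.inr (.inr (.inr (.inl ⟨(c, u), hp⟩))), rfl⟩
  · exact ⟨.inr (.inr (.inr (.inr true))), rfl⟩
  · exact ⟨.inr (.inr (.inr (.inr false))), rfl⟩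

/-- A bound on the lengths of the words from which the plays of `G` are built. -/
theorem Choices.exists_length_bound (ch : Choices G lam i β) : ∃ D : ℕ,
    (∀ F : ConsFamily G lam β, F.h.length ≤ D ∧ F.c.length ≤ D) ∧
    (∀ (F : ConsFamily G lam β) h' v, F.IsPreDev i h' v → h'.length ≤ D) ∧
    ∀ g (F : ConsFamily G lam β) u, F.IsPostDev i u → (ch.path g F u).length ≤ D := by
  -- A connecting word may depend on `g`, but its length, being minimal, does not; the empty history
  -- suffices.
  obtain ⟨D, hD⟩ := Finite.bddAbove_range
    (fun x : ConsFamily G lam β × V => (ch.path [] x.1 x.2).length)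
  refine ⟨D + (Nat.card V + Nat.card V), fun F => ?_, fun F h' v h => ?_, fun g F u h => ?_⟩
  · have := F.h_simple.length_le_natCard
    have := F.c_simple.length_le_natCard
    constructor <;> omega
  · exact h.length_le.trans (by omega)
  · have h1 := ch.path_shortest g F u h _ (ch.path_spec [] F u h)
    have h2 : (ch.path [] F u).length ≤ D := hD ⟨(F, u), rfl⟩
    omega

end Finiteness

/-! ### The auxiliary mean-payoff game. -/

section Weights

variable {P V : Type*} [Fintype P] {G : MeanPayoffGame P V} {lam : V → EReal} {i : P} {β : ℕ}

/-- The total weight of the punishing cycle. -/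
def ConsFamily.cycleSum (R : V → V → ℝ) (F : ConsFamily G lam β) : ℝ :=
  wordSum R (F.c ++ [F.c.head F.c_ne_nil])

/-- The vertex at which the construction of the play of `G` continues; `d` is a dummy vertex. -/
def RedState.cur (d : V) : RedState G lam i β → V
  | .vertex v => v
  | .proposal F => F.first
  | .pre _ v _ => v
  | .post _ u _ => u
  | _ => d

/-- The number of transitions, up to a constant, since the last deviation. -/
def RedState.rank : RedState G lam i β → ℕ
  | .vertex _ => 1
  | .proposal _ => 2
  | _ => 0

/-- The transitions of a variant of the reduced negotiation game in which Challenger loses when he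
accepts a family of payoff at most `α`, and wins when a family of larger payoff is proposed. -/
def ThresholdEdge (α : ℝ) : RedState G lam i β → RedState G lam i β → Prop
  | .proposal F, t => if α < (F.x i : ℝ) then t = .bot else RedEdge (.proposal F) t
  | s, t => RedEdge s t

open Classical in
/-- The weights of transitions for which the variant is a mean-payoff game: a transition through a
punishing cycle outweighs all the other ones, and even more so if it is favorable to Prover. -/
noncomputable def redWeight (R : V → V → ℝ) (K L : ℝ) :
    RedState G lam i β → RedState G lam i β → ℝ
  | .proposal _, .pre h' v _ => wordSum R (h' ++ [v])
  | .proposal F, .post _ _ _ => if F.cycleSum R ≤ 0 then -L else K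
  | .bot, .bot => 1
  | _, _ => 0

end Weights

/-! ### Endless plays and the words they construct. -/

section Plays

variable {P V : Type*} [Fintype P] {G : MeanPayoffGame P V} {lam : V → EReal} {i : P} {β : ℕ}
  {ch : Choices G lam i β} {d : V} {π : ℕ → RedState G lam i β}

/-- A play of the reduced negotiation game that never ends. -/
structure IsEndless (π : ℕ → RedState G lam i β) : Prop where
  edge : ∀ n, RedEdge (π n) (π (n + 1))
  start : ∃ v, π 0 = .vertex v
  ne_top : ∀ n, π n ≠ .top
  ne_bot : ∀ n, π n ≠ .bot

theorem ConsFamily.IsPreDev.head {F : ConsFamily G lam β} {h' : List V} {v : V}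
    (h : F.IsPreDev i h' v) : ∃ l, h' = F.first :: l := by
  obtain ⟨⟨q, hq⟩, w, hw, -⟩ := h
  cases h' with
  | nil => simp at hw
  | cons a l =>
    refine ⟨l, ?_⟩
    simp [ConsFamily.first, ← hq]

theorem Choices.path_ne_nil (ch : Choices G lam i β) (g : List V) {F : ConsFamily G lam β} {u : V}
    (h : F.IsPostDev i u) : ch.path g F u ≠ [] := by
  obtain ⟨-, -, w, hw, -⟩ := ch.path_spec g F u h
  rintro he
  simp [he] at hw

/-- A round has three transitions and its deviation appends at least one letter; `rank` records the
position in the round. This turns a loss of `ε` per transition into `3 * ε` per edge of `G`. -/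
theorem IsEndless.le_length (hπ : IsEndless π) (n : ℕ) :
    n + 1 ≤ 3 * (dotHist ch π n).length + (π n).rank := by
  induction n with
  | zero =>
    obtain ⟨v, hv⟩ := hπ.start
    simp [hv, RedState.rank]
  | succ n ih =>
    have he := hπ.edge n
    have h1 := hπ.ne_top (n + 1)
    have h2 := hπ.ne_bot (n + 1)
    simp only [dotHist, List.length_append]
    generalize dotHist ch π n = g at *
    generalize π n = s at *
    generalize π (n + 1) = t at *
    cases he with
    | propose => simp [RedState.rank, dotPiece] at ih ⊢; omega
    | preDev F h' v hd =>
      obtain ⟨l, rfl⟩ := hd.head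
      simp [RedState.rank, dotPiece] at ih ⊢; omega
    | postDev F u hd =>
      have := List.length_pos_iff.2 (ch.path_ne_nil g hd)
      simp [RedState.rank, dotPiece] at ih ⊢; omega
    | preBack => simp [RedState.rank, dotPiece] at ih ⊢; omega
    | postBack => simp [RedState.rank, dotPiece] at ih ⊢; omega
    | _ => contradiction

theorem IsEndless.tendsto_length (hπ : IsEndless π) :
    Tendsto (fun n => (dotHist ch π n).length) atTop atTop := by
  rw [tendsto_atTop]
  intro b
  filter_upwards [eventually_ge_atTop (3 * b + 1)] with n hn
  have := hπ.le_length (ch := ch) n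
  have : (π n).rank ≤ 2 := by cases π n <;> simp [RedState.rank]
  omega

theorem limitWord_dotHist (n : ℕ) {l : List V} (hl : l <+: dotHist ch π n) (k : ℕ)
    (hk : k < l.length) : limitWord d (dotHist ch π) k = l[k] := by
  rw [hl.getElem hk]
  exact limitWord_eq d _ (fun n => List.prefix_append _ _) n k _

/-- The weight of the history constructed so far, up to the vertex where it continues. -/
def histSum (ch : Choices G lam i β) (d : V) (R : V → V → ℝ) (π : ℕ → RedState G lam i β)
    (n : ℕ) : ℝ :=
  wordSum R (dotHist ch π n ++ [(π n).cur d])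

/-- Additivity is exact because `histSum` includes the current vertex, which is the first letter of
the next word appended by a pre-cycle deviation. -/
theorem IsEndless.histSum_succ (hπ : IsEndless π) (R : V → V → ℝ) (K L : ℝ) (n : ℕ)
    (hpost : ∀ c u hp, π (n + 1) ≠ .post c u hp) :
    histSum ch d R π (n + 1) = histSum ch d R π n + redWeight R K L (π n) (π (n + 1)) := by
  have he := hπ.edge n
  have h1 := hπ.ne_top (n + 1)
  have h2 := hπ.ne_bot (n + 1)
  simp only [dotHist, histSum]
  generalize dotHist ch π n = g at *
  generalize π n = s at *
  generalize π (n + 1) = t at *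
  cases he with
  | propose _ _ hF => simp [RedState.cur, dotPiece, redWeight, hF]
  | preDev F h' v hd =>
    obtain ⟨l, rfl⟩ := hd.head
    simp only [RedState.cur, dotPiece, redWeight, List.append_assoc, List.cons_append]
    exact wordSum_append_cons _ _ _
  | postDev F u hd => exact absurd rfl (hpost _ _ _)
  | preBack => simp [RedState.cur, dotPiece, redWeight]
  | postBack => simp [RedState.cur, dotPiece, redWeight]
  | _ => contradiction

end Plays

/-! ### Effect of one transition on the constructed history. -/

section Payoffs

variable {P V : Type*} [Fintype P] {G : MeanPayoffGame P V} {lam : V → EReal} {i : P} {β : ℕ}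
  {ch : Choices G lam i β} {d : V} {π : ℕ → RedState G lam i β}

/-- A transition through the punishing cycle of a proposed family with a given property. -/
def IsPostOf (p : ConsFamily G lam β → Prop) (s t : RedState G lam i β) : Prop :=
  ∃ F c u hp, s = .proposal F ∧ t = .post c u hp ∧ p F

theorem IsPostOf.intro {s t : RedState G lam i β} (h : RedEdge s t) {c u hp}
    (ht : t = .post c u hp) {p : ConsFamily G lam β → Prop}
    (hs : ∀ F, s = .proposal F → p F) : IsPostOf p s t := by
  cases h with
  | postDev F u hd => exact ⟨F, _, u, _, rfl, rfl, hs F rfl⟩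
  | _ => cases ht

variable {R : V → V → ℝ} {M K L : ℝ} {D : ℕ}

theorem abs_redWeight_le (hM : ∀ a b, |R a b| ≤ M) (hM0 : 0 ≤ M)
    (hD : ∀ (F : ConsFamily G lam β) h' v, F.IsPreDev i h' v → h'.length ≤ D)
    {s t : RedState G lam i β} (h : RedEdge s t) (hbot : t ≠ .bot)
    (hpost : ¬ IsPostOf (fun _ => True) s t) : |redWeight R K L s t| ≤ M * (D + 1) := by
  have h0 : |(0 : ℝ)| ≤ M * (D + 1) := by rw [abs_zero]; positivity
  cases h with
  | preDev F h' v hd =>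
    refine (abs_wordSum_le hM hM0 (h' ++ [v])).trans ?_
    have : ((h' ++ [v]).length : ℝ) ≤ D + 1 := by
      rw [List.length_append]
      exact_mod_cast Nat.add_le_add_right (hD F h' v hd) 1
    gcongr
  | postDev F u hd => exact absurd ⟨F, _, u, _, rfl, rfl, trivial⟩ hpost
  | botLoop => contradiction
  | _ => exact h0

theorem redWeight_of_isPostOf_pos {s t : RedState G lam i β}
    (h : IsPostOf (fun F => 0 < F.cycleSum R) s t) : redWeight R K L s t = K := by
  obtain ⟨F, c, u, hp, rfl, rfl, hF⟩ := h
  simp [redWeight, not_le.2 hF]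

theorem redWeight_of_isPostOf_nonpos {s t : RedState G lam i β}
    (h : IsPostOf (fun F => F.cycleSum R ≤ 0) s t) : redWeight R K L s t = -L := by
  obtain ⟨F, c, u, hp, rfl, rfl, hF⟩ := h
  simp [redWeight, hF]

theorem isPostOf_pos {s t : RedState G lam i β} (h : IsPostOf (fun _ => True) s t)
    (hn : ¬ IsPostOf (fun F => F.cycleSum R ≤ 0) s t) : IsPostOf (fun F => 0 < F.cycleSum R) s t := by
  obtain ⟨F, c, u, hp, rfl, rfl, -⟩ := h
  refine ⟨F, c, u, hp, rfl, rfl, ?_⟩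
  by_contra hF
  exact hn ⟨F, c, u, hp, rfl, rfl, not_lt.1 hF⟩

theorem IsEndless.histSum_succ' (hπ : IsEndless π) (R : V → V → ℝ) (K L : ℝ) (n : ℕ)
    (hpost : ¬ IsPostOf (fun _ => True) (π n) (π (n + 1))) :
    histSum ch d R π (n + 1) = histSum ch d R π n + redWeight R K L (π n) (π (n + 1)) :=
  hπ.histSum_succ R K L n fun _ _ _ ht => hpost (.intro (hπ.edge n) ht fun _ _ => trivial)

theorem wordSum_append_le (hM : ∀ a b, |R a b| ≤ M) (hM0 : 0 ≤ M) (l l' : List V) :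
    wordSum R (l ++ l') ≤ wordSum R l + wordSum R l' + M := by
  have := (abs_le.1 (abs_wordSum_append hM hM0 l l')).2
  linarith

theorem le_wordSum_append (hM : ∀ a b, |R a b| ≤ M) (hM0 : 0 ≤ M) (l l' : List V) :
    wordSum R l + wordSum R l' - M ≤ wordSum R (l ++ l') := by
  have := (abs_le.1 (abs_wordSum_append hM hM0 l l')).1
  linarith

theorem le_wordSum_of_length_le (hM : ∀ a b, |R a b| ≤ M) (hM0 : 0 ≤ M) {l : List V}
    (h : l.length ≤ D) : -(M * D) ≤ wordSum R l := by
  have h1 := (abs_le.1 (abs_wordSum_le hM hM0 l)).1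
  have h2 : M * l.length ≤ M * D := by gcongr
  linarith

theorem abs_wordSum_wordPow_sub (hM : ∀ a b, |R a b| ≤ M) (hM0 : 0 ≤ M) (F : ConsFamily G lam β)
    (n : ℕ) : |n * F.cycleSum R - wordSum R (wordPow F.c n)| ≤ M := by
  rw [ConsFamily.cycleSum, ← wordSum_wordPow]
  exact abs_wordSum_append_singleton hM hM0 _ _

/-- Repeating a nonpositive cycle adds at most a constant: the weight stays linear in `|gh|`, while
the length is quadratic. -/
theorem wordSum_append_punish_le (hM : ∀ a b, |R a b| ≤ M) (hM0 : 0 ≤ M) (g : List V)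
    (F : ConsFamily G lam β) (hF : F.cycleSum R ≤ 0) :
    wordSum R (g ++ F.punish g) ≤ M * (g ++ F.h).length + 2 * M := by
  rw [ConsFamily.punish, ← List.append_assoc]
  have h1 := wordSum_append_le hM hM0 (g ++ F.h) (wordPow F.c ((g ++ F.h).length ^ 2))
  have h2 := (abs_le.1 (abs_wordSum_wordPow_sub hM hM0 F ((g ++ F.h).length ^ 2))).1
  have h3 := (abs_le.1 (abs_wordSum_le hM hM0 (g ++ F.h))).2
  have h4 : (((g ++ F.h).length ^ 2 : ℕ) : ℝ) * F.cycleSum R ≤ 0 :=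
    mul_nonpos_of_nonneg_of_nonpos (Nat.cast_nonneg _) hF
  linarith

/-- A lower bound on a limit inferior also has to hold in the middle of an appended word. The point
is that the loss there is bounded independently of `g`. -/
theorem le_wordSum_take_dotPiece (hM : ∀ a b, |R a b| ≤ M) (hM0 : 0 ≤ M)
    (hDF : ∀ F : ConsFamily G lam β, F.h.length ≤ D ∧ F.c.length ≤ D)
    (hD : ∀ (F : ConsFamily G lam β) h' v, F.IsPreDev i h' v → h'.length ≤ D)
    (hDp : ∀ g (F : ConsFamily G lam β) u, F.IsPostDev i u → (ch.path g F u).length ≤ D)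
    {s t : RedState G lam i β} (h : RedEdge s t)
    (hpost : ¬ IsPostOf (fun F => F.cycleSum R ≤ 0) s t) (g : List V) (j : ℕ) :
    -(M * (3 * D + 2)) ≤ wordSum R ((dotPiece ch g s t).take j) := by
  have hMD : 0 ≤ M * D := by positivity
  have h0 : -(M * (3 * D + 2)) ≤ 0 := by
    have : 0 ≤ M * (3 * D + 2) := by positivity
    linarith
  cases h with
  | preDev F h' v hd =>
    have := le_wordSum_of_length_le hM hM0
      ((List.length_take_le' j h').trans (hD F h' v hd))
    simp only [dotPiece]
    linarith
  | postDev F u hd =>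
    have hF : 0 ≤ F.cycleSum R := by
      by_contra hF
      exact hpost ⟨F, _, u, _, rfl, rfl, (not_le.1 hF).le⟩
    simp only [dotPiece, ConsFamily.punish, List.append_assoc, List.take_append]
    set m := (g ++ F.h).length ^ 2
    have h1 := le_wordSum_of_length_le hM hM0 ((List.length_take_le' j F.h).trans (hDF F).1)
    have h2 := le_wordSum_take_wordPow hM hM0 F.c F.c_ne_nil hF m (j - F.h.length)
    have h3 := le_wordSum_of_length_le hM hM0 ((List.length_take_le'
      (j - F.h.length - (wordPow F.c m).length) (ch.path g F u)).trans (hDp g F u hd))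
    have h4 : M * F.c.length ≤ M * D := by
      have := (hDF F).2
      gcongr
    refine le_trans ?_ (le_wordSum_append hM hM0 _ _)
    have h5 := le_wordSum_append hM hM0 ((wordPow F.c m).take (j - F.h.length))
      ((ch.path g F u).take (j - F.h.length - (wordPow F.c m).length))
    linarith
  | _ => simpa [dotPiece, wordSum] using h0

theorem le_histSum_succ_of_isPostOf (hM : ∀ a b, |R a b| ≤ M) (hM0 : 0 ≤ M)
    (hDF : ∀ F : ConsFamily G lam β, F.h.length ≤ D ∧ F.c.length ≤ D)
    (hDp : ∀ g (F : ConsFamily G lam β) u, F.IsPostDev i u → (ch.path g F u).length ≤ D)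
    {κ : ℝ} (hκ : 0 ≤ κ) {n : ℕ} (hedge : RedEdge (π n) (π (n + 1)))
    (h : IsPostOf (fun F => κ ≤ F.cycleSum R) (π n) (π (n + 1))) :
    histSum ch d R π n + (dotHist ch π n).length ^ 2 * κ - M * (2 * D + 6) ≤
      histSum ch d R π (n + 1) := by
  obtain ⟨F, c, u, hp, hs, ht, hF⟩ := h
  have hd : F.IsPostDev i u := by
    rw [hs, ht] at hedge
    cases hedge
    assumption
  simp only [histSum, dotHist]
  rw [hs, ht]
  set g := dotHist ch π n
  simp only [dotPiece, ConsFamily.punish, RedState.cur, List.append_assoc]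
  set m := (g ++ F.h).length ^ 2 with hm
  have hgm : (g.length : ℝ) ^ 2 * κ ≤ m * F.cycleSum R := by
    have h1 : (g.length : ℝ) ^ 2 ≤ m := by
      rw [hm]
      push_cast [List.length_append]
      gcongr
      have : (0 : ℝ) ≤ F.h.length := by positivity
      linarith
    gcongr
  have h1 := (abs_le.1 (abs_wordSum_append_singleton hM hM0 g F.first)).2
  have h2 := le_wordSum_of_length_le hM hM0 (hDF F).1
  have h3 := (abs_le.1 (abs_wordSum_wordPow_sub hM hM0 F m)).2
  have h4 := le_wordSum_of_length_le hM hM0 (hDp g F u hd)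
  have h5 := (abs_le.1 (abs_wordSum_append_singleton hM hM0 (ch.path g F u) u)).1
  have h6 := le_wordSum_append hM hM0 (wordPow F.c m) (ch.path g F u ++ [u])
  have h7 := le_wordSum_append hM hM0 F.h (wordPow F.c m ++ (ch.path g F u ++ [u]))
  have h8 := le_wordSum_append hM hM0 g (F.h ++ (wordPow F.c m ++ (ch.path g F u ++ [u])))
  linarith

end Payoffs

/-! ### From potentials to bounds on the mean payoff. -/

section Potentials

variable {P V : Type*} [Fintype P] [Finite V] {G : MeanPayoffGame P V} {lam : V → EReal} {i : P}
  {β : ℕ} {ch : Choices G lam i β} {d : V} {π : ℕ → RedState G lam i β} {α M K L : ℝ} {D N : ℕ}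

theorem IsEndless.mu_le (hπ : IsEndless π)
    (hM : ∀ a b, |(G.reward i a b : ℝ) - α| ≤ M) (hM0 : 0 ≤ M)
    (hD : ∀ (F : ConsFamily G lam β) h' v, F.IsPreDev i h' v → h'.length ≤ D)
    (hN : ∀ (φ : RedState G lam i β → ℝ) (D : ℝ) (π : ℕ → RedState G lam i β), 0 ≤ D →
      (∀ᶠ n in atTop, φ (π (n + 1)) ≤ φ (π n) + D) →
      ¬ ∃ᶠ n in atTop, φ (π (n + 1)) + N * D < φ (π n))
    (hK : N * (M * (D + 1) + 1) + 1 ≤ K) {ε : ℝ} (hε0 : 0 < ε) (hε1 : ε ≤ 1)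
    (φ : RedState G lam i β → ℝ)
    (hφ : ∀ n, redWeight (fun a b => (G.reward i a b : ℝ) - α) K L (π n) (π (n + 1)) +
      φ (π (n + 1)) < φ (π n) + ε) :
    G.mu i (limitWord d (dotHist ch π)) ≤ α + 3 * ε := by
  set R : V → V → ℝ := fun a b => (G.reward i a b : ℝ) - α with hR
  have hK0 : 0 ≤ K := le_trans (by positivity) hK
  have hB : 0 ≤ M * (D + 1) := by positivity
  set ρ := limitWord d (dotHist ch π) with hρ
  have hsub : ∀ n : ℕ, ∑ k ∈ Finset.range n,
      ((G.reward i (ρ k) (ρ (k + 1)) : ℝ) - (α + 3 * ε)) =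
      ∑ k ∈ Finset.range n, R (ρ k) (ρ (k + 1)) - n * (3 * ε) := by
    intro n
    simp only [hR, Finset.sum_sub_distrib, Finset.sum_const, Finset.card_range, nsmul_eq_mul]
    ring
  have hlarge : ∀ C δ : ℝ, 0 < δ → ∀ᶠ n in atTop, C ≤ δ * ((dotHist ch π n).length : ℝ) :=
    fun C δ hδ => ((tendsto_natCast_atTop_atTop.comp hπ.tendsto_length).const_mul_atTop
      hδ).eventually_ge_atTop C
  rw [MeanPayoffGame.mu_le_iff]
  intro δ hδ
  -- With infinitely many nonpositive crossings, look right after the repetitions: the weight is at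
  -- most linear in `T = |gh|`, over a length of at least `T ^ 2`. The potential is not needed.
  by_cases hgood : ∃ᶠ n in atTop, IsPostOf (fun F => F.cycleSum R ≤ 0) (π n) (π (n + 1))
  · rw [frequently_atTop]
    intro m₀
    obtain ⟨n, ⟨F, c, u, hp, hs, ht, hF⟩, ⟨h1, h2⟩, h3⟩ := (hgood.and_eventually
      ((hlarge (4 * M) δ hδ).and (hπ.tendsto_length.eventually_ge_atTop 1) |>.and
        (hπ.tendsto_length.eventually_ge_atTop m₀))).exists
    set g := dotHist ch π n with hg
    have hpre : g ++ F.punish g <+: dotHist ch π (n + 1) := by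
      refine ⟨ch.path g F u, ?_⟩
      simp [dotHist, hs, ht, dotPiece, hg]
    refine ⟨(g ++ F.punish g).length, ?_, ?_⟩
    · rw [List.length_append]
      exact le_add_right h3
    rw [hsub]
    have h4 := (abs_le.1 (abs_sum_sub_wordSum_le hM hM0 ρ _
      fun k hk => limitWord_dotHist (n + 1) hpre k hk)).2
    have h5 := wordSum_append_punish_le hM hM0 g F hF
    set T : ℕ := (g ++ F.h).length with hT
    have hgT : (g.length : ℝ) ≤ T := by
      rw [hT, List.length_append]
      push_cast
      linarith [(Nat.cast_nonneg F.h.length : (0 : ℝ) ≤ _)]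
    have hT1 : (1 : ℝ) ≤ T := le_trans (by exact_mod_cast h2) hgT
    have hlen : (T : ℝ) ^ 2 ≤ ((g ++ F.punish g).length : ℝ) := by
      have hc : 1 ≤ F.c.length := List.length_pos_iff.2 F.c_ne_nil
      have : T ^ 2 ≤ (g ++ F.punish g).length := by
        rw [ConsFamily.punish, List.length_append, List.length_append, length_wordPow]
        nlinarith [Nat.mul_le_mul_left (T ^ 2) hc]
      exact_mod_cast this
    have h6 : δ * (T : ℝ) ^ 2 ≤ δ * ((g ++ F.punish g).length : ℝ) := by gcongr
    have h7 : δ * (g.length : ℝ) ≤ δ * T := by gcongr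
    have h8 : M * T + 3 * M ≤ δ * (T : ℝ) ^ 2 := by nlinarith
    have h9 : 0 ≤ ((g ++ F.punish g).length : ℝ) * (3 * ε) := by positivity
    linarith
  -- Eventually `φ` rises by at most `M * (D + 1) + 1` per step, while a positive crossing lowers it
  -- by more than `K - 1`, that is by more than `N` times this. So all crossings stop, and the
  -- weights become those of the appended words.
  · rw [not_frequently] at hgood
    have hstep : ∀ᶠ n in atTop, φ (π (n + 1)) ≤ φ (π n) + (M * (D + 1) + 1) := by
      filter_upwards [hgood] with n hn
      have h1 := hφ n
      by_cases hp : IsPostOf (fun _ => True) (π n) (π (n + 1))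
      · rw [redWeight_of_isPostOf_pos (isPostOf_pos hp hn)] at h1
        linarith
      · have := (abs_le.1 (abs_redWeight_le (K := K) (L := L) hM hM0 hD (hπ.edge n)
          (hπ.ne_bot (n + 1)) hp)).1
        linarith
    have hno : ∀ᶠ n in atTop, ¬ IsPostOf (fun _ => True) (π n) (π (n + 1)) := by
      have := hN φ _ π (by positivity) hstep
      rw [not_frequently] at this
      filter_upwards [hgood, this] with n hn hn' hp
      have h1 := hφ n
      rw [redWeight_of_isPostOf_pos (isPostOf_pos hp hn)] at h1
      exact hn' (by linarith)
    obtain ⟨n₀, hn₀⟩ := eventually_atTop.1 hno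
    obtain ⟨C, hC⟩ := Finite.bddAbove_range fun s => -φ s
    have hsum : ∀ n ≥ n₀, histSum ch d R π n + φ (π n) ≤
        histSum ch d R π n₀ + φ (π n₀) + ε * n := by
      intro n hn
      induction n, hn using Nat.le_induction with
      | base => have : 0 ≤ ε * n₀ := by positivity
                linarith
      | succ n hn ih =>
        rw [hπ.histSum_succ' R K L n (hn₀ n hn)]
        have := hφ n
        push_cast
        linarith
    refine (hπ.tendsto_length (ch := ch)).frequently (Eventually.frequently ?_)
    filter_upwards [eventually_ge_atTop n₀,
      hlarge (histSum ch d R π n₀ + φ (π n₀) + C + 2 * ε + 2 * M) δ hδ] with n hn hn'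
    rw [hsub]
    have h1 := (abs_le.1 (abs_sum_sub_wordSum_le hM hM0 ρ _
      fun k hk => limitWord_dotHist n List.prefix_rfl k hk)).2
    have h2 := (abs_le.1 (abs_wordSum_append_singleton hM hM0 (dotHist ch π n) ((π n).cur d))).1
    have h3 := hsum n hn
    have h4 : -φ (π n) ≤ C := hC ⟨π n, rfl⟩
    have h5 : (n : ℝ) ≤ 3 * (dotHist ch π n).length + 2 := by
      have := hπ.le_length (ch := ch) n
      have : (π n).rank ≤ 2 := by cases π n <;> simp [RedState.rank]
      have : n ≤ 3 * (dotHist ch π n).length + 2 := by omega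
      exact_mod_cast this
    have h6 : ε * n ≤ ε * (3 * (dotHist ch π n).length + 2) := by gcongr
    simp only [histSum] at h3 hn'
    linarith

theorem IsEndless.le_mu (hπ : IsEndless π)
    (hM : ∀ a b, |(G.reward i a b : ℝ) - α| ≤ M) (hM0 : 0 ≤ M)
    (hDF : ∀ F : ConsFamily G lam β, F.h.length ≤ D ∧ F.c.length ≤ D)
    (hD : ∀ (F : ConsFamily G lam β) h' v, F.IsPreDev i h' v → h'.length ≤ D)
    (hDp : ∀ g (F : ConsFamily G lam β) u, F.IsPostDev i u → (ch.path g F u).length ≤ D)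
    (hN : ∀ (φ : RedState G lam i β → ℝ) (D : ℝ) (π : ℕ → RedState G lam i β), 0 ≤ D →
      (∀ᶠ n in atTop, φ (π (n + 1)) ≤ φ (π n) + D) →
      ¬ ∃ᶠ n in atTop, φ (π (n + 1)) + N * D < φ (π n))
    (hK : M * (D + 1) ≤ K) (hL : N * K ≤ L)
    (φ : RedState G lam i β → ℝ)
    (hφ : ∀ n, φ (π n) <
      redWeight (fun a b => (G.reward i a b : ℝ) - α) K L (π n) (π (n + 1)) + φ (π (n + 1))) :
    α ≤ G.mu i (limitWord d (dotHist ch π)) := by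
  set R : V → V → ℝ := fun a b => (G.reward i a b : ℝ) - α with hR
  have hB : 0 ≤ M * (D + 1) := by positivity
  have hK0 : 0 ≤ K := hB.trans hK
  have hL0 : 0 ≤ L := le_trans (by positivity) hL
  set ρ := limitWord d (dotHist ch π) with hρ
  -- The drop argument for `-φ`: it grows by at most `K` per step, and a nonpositive crossing lowers
  -- it by more than `L ≥ N * K`.
  have hgood : ∀ᶠ n in atTop, ¬ IsPostOf (fun F => F.cycleSum R ≤ 0) (π n) (π (n + 1)) := by
    rw [← not_frequently]
    intro hfreq
    refine hN (fun s => -φ s) K π hK0 (Eventually.of_forall fun n => ?_) (hfreq.mono fun n hn => ?_)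
    · have h1 := hφ n
      by_cases hp : IsPostOf (fun _ => True) (π n) (π (n + 1))
      · by_cases hn : IsPostOf (fun F => F.cycleSum R ≤ 0) (π n) (π (n + 1))
        · rw [redWeight_of_isPostOf_nonpos hn] at h1
          linarith
        · rw [redWeight_of_isPostOf_pos (isPostOf_pos hp hn)] at h1
          linarith
      · have := (abs_le.1 (abs_redWeight_le (K := K) (L := L) hM hM0 hD (hπ.edge n)
          (hπ.ne_bot (n + 1)) hp)).2
        linarith
    · have h1 := hφ n
      rw [redWeight_of_isPostOf_nonpos hn] at h1
      linarith
  obtain ⟨C, hC⟩ := Finite.bddAbove_range fun s => |φ s|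
  replace hC : ∀ s, |φ s| ≤ C := fun s => hC ⟨s, rfl⟩
  -- Finitely many families, so positive cycle weights are bounded away from zero. The gain of order
  -- `κ * |g| ^ 2` then outweighs the oscillation of `φ` and the constant losses of a crossing.
  obtain ⟨κ, hκ0, hκ⟩ : ∃ κ > 0, ∀ F : ConsFamily G lam β, 0 < F.cycleSum R → κ ≤ F.cycleSum R := by
    rcases isEmpty_or_nonempty {F : ConsFamily G lam β // 0 < F.cycleSum R} with he | he
    · exact ⟨1, one_pos, fun F hF => (he.false ⟨F, hF⟩).elim⟩
    · obtain ⟨F₀, hF₀⟩ := Finite.exists_min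
        fun F : {F : ConsFamily G lam β // 0 < F.cycleSum R} => F.1.cycleSum R
      exact ⟨_, F₀.2, fun F hF => hF₀ ⟨F, hF⟩⟩
  have hmono : ∀ᶠ n in atTop, histSum ch d R π n + φ (π n) ≤
      histSum ch d R π (n + 1) + φ (π (n + 1)) := by
    have hlarge : ∀ᶠ n in atTop, M * (2 * D + 6) + 2 * C ≤
        κ * ((dotHist ch π n).length : ℝ) :=
      ((tendsto_natCast_atTop_atTop.comp hπ.tendsto_length).const_mul_atTop
        hκ0).eventually_ge_atTop _
    filter_upwards [hgood, hlarge, hπ.tendsto_length.eventually_ge_atTop 1] with n hn hn' hn1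
    by_cases hp : IsPostOf (fun _ => True) (π n) (π (n + 1))
    · have hpos : IsPostOf (fun F => κ ≤ F.cycleSum R) (π n) (π (n + 1)) := by
        obtain ⟨F, c, u, hp, hs, ht, hF⟩ := isPostOf_pos hp hn
        exact ⟨F, c, u, hp, hs, ht, hκ F hF⟩
      have h1 := le_histSum_succ_of_isPostOf (d := d) hM hM0 hDF hDp hκ0.le (hπ.edge n) hpos
      have h2 := (abs_le.1 (hC (π n))).2
      have h3 := (abs_le.1 (hC (π (n + 1)))).1
      have h4 : (1 : ℝ) ≤ (dotHist ch π n).length := by exact_mod_cast hn1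
      have h5 : κ * ((dotHist ch π n).length : ℝ) ≤ (dotHist ch π n).length ^ 2 * κ := by
        nlinarith [mul_nonneg hκ0.le (sub_nonneg.2 h4)]
      linarith
    · rw [hπ.histSum_succ' R K L n hp]
      linarith [hφ n]
  obtain ⟨n₀, hn₀⟩ := eventually_atTop.1 (hmono.and hgood)
  have hsum : ∀ n ≥ n₀, histSum ch d R π n₀ + φ (π n₀) ≤ histSum ch d R π n + φ (π n) := by
    intro n hn
    induction n, hn using Nat.le_induction with
    | base => exact le_rfl
    | succ n hn ih => exact ih.trans (hn₀ n hn).1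
  -- Any position `m` lies inside some appended word, whose truncation costs a bounded amount.
  have hbelow : ∀ m ≥ (dotHist ch π n₀).length,
      histSum ch d R π n₀ + φ (π n₀) - C - 3 * M - M * (3 * D + 2) ≤
        ∑ k ∈ Finset.range m, R (ρ k) (ρ (k + 1)) := by
    intro m hm
    obtain ⟨n, hn, hnm, hmn⟩ : ∃ n ≥ n₀, (dotHist ch π n).length ≤ m ∧
        m < (dotHist ch π (n + 1)).length := by
      by_contra! hcon
      have : ∀ n ≥ n₀, (dotHist ch π n).length ≤ m := by
        intro n hn
        induction n, hn using Nat.le_induction with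
        | base => exact hm
        | succ n hn ih => exact hcon n hn ih
      obtain ⟨n, h1, h2⟩ := ((eventually_ge_atTop n₀).and
        ((hπ.tendsto_length (ch := ch)).eventually_gt_atTop m)).exists
      exact absurd (this n h1) (not_le.2 h2)
    have hlen : ((dotHist ch π (n + 1)).take m).length = m := by
      rw [List.length_take]; omega
    have h1 := (abs_le.1 (abs_sum_sub_wordSum_le hM hM0 ρ _
      fun k hk => limitWord_dotHist (n + 1) (List.take_prefix m _) k hk)).1
    rw [hlen] at h1
    have htake : (dotHist ch π (n + 1)).take m = dotHist ch π n ++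
        (dotPiece ch (dotHist ch π n) (π n) (π (n + 1))).take (m - (dotHist ch π n).length) := by
      rw [dotHist, List.take_append, List.take_of_length_le hnm]
    rw [htake] at h1
    have h2 := le_wordSum_append hM hM0 (dotHist ch π n)
      ((dotPiece ch (dotHist ch π n) (π n) (π (n + 1))).take (m - (dotHist ch π n).length))
    have h3 := le_wordSum_take_dotPiece (ch := ch) hM hM0 hDF hD hDp (hπ.edge n) (hn₀ n hn).2
      (dotHist ch π n) (m - (dotHist ch π n).length)
    have h4 := (abs_le.1 (abs_wordSum_append_singleton hM hM0 (dotHist ch π n) ((π n).cur d))).2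
    have h5 := hsum n hn
    have h6 := (abs_le.1 (hC (π n))).2
    simp only [histSum] at h5 ⊢
    linarith
  rw [MeanPayoffGame.le_mu_iff]
  intro δ hδ
  filter_upwards [eventually_ge_atTop (dotHist ch π n₀).length,
    (tendsto_natCast_atTop_atTop.const_mul_atTop hδ).eventually_ge_atTop
      (-(histSum ch d R π n₀ + φ (π n₀) - C - 3 * M - M * (3 * D + 2)))] with m hm hm'
  have := hbelow m hm
  linarith

end Potentials

/-! ### Outcomes and positional strategies. -/

namespace Arena

variable {P S : Type*} (A : Arena P S) {s₀ : S} (σ : ∀ p, A.Strategy s₀ p)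

theorem isHistFrom_outcomeAux (n : ℕ) :
    A.IsHistFrom s₀ ((A.outcomeAux s₀ σ n).1 ++ [(A.outcomeAux s₀ σ n).2]) := by
  induction n with
  | zero => exact ⟨rfl, List.isChain_singleton _⟩
  | succ n ih =>
    refine ⟨?_, ?_⟩
    · simp only [outcomeAux]
      rw [List.head?_append_of_ne_nil _ (by simp)]
      exact ih.1
    · simp only [outcomeAux]
      rw [List.isChain_append]
      refine ⟨ih.2, List.isChain_singleton _, ?_⟩
      simpa using (σ _).edge_next _ _ ih rfl

theorem edge_outcome (n : ℕ) : A.Edge (A.outcome s₀ σ n) (A.outcome s₀ σ (n + 1)) :=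
  (σ _).edge_next _ _ (A.isHistFrom_outcomeAux σ n) rfl

theorem outcome_succ {n : ℕ} {p : P} (h : A.owner (A.outcome s₀ σ n) = p) :
    A.outcome s₀ σ (n + 1) = (σ p).next (A.outcomeAux s₀ σ n).1 (A.outcome s₀ σ n) := by
  subst h
  rfl

/-- A positional strategy. -/
def positional (s₀ : S) {p : P} (f : S → S) (hf : ∀ s, A.owner s = p → A.Edge s (f s)) :
    A.Strategy s₀ p where
  next _ s := f s
  edge_next _ s _ hs := hf s hs

end Arena

/-! ### Positional determinacy for each threshold. -/

section Determinacy

variable {P V : Type*} [Fintype P] {G : MeanPayoffGame P V} {lam : V → EReal} {i : P} {β : ℕ}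
  {ch : Choices G lam i β} {v₀ : V} {π : ℕ → RedState G lam i β}

theorem challengerPayoff_of_bot {n : ℕ} (h : π n = .bot) : challengerPayoff ch v₀ π = ⊤ :=
  if_pos ⟨n, h⟩

/-- `⊤` is entered only by acceptance, and by prefix independence the payoff is that of the tail,
whatever the representative. The witness is the one chosen in `dotPlay`, so no uniqueness is needed.
-/
theorem exists_accepted [Finite V] (hedge : ∀ n, RedEdge (π n) (π (n + 1))) (h0 : π 0 = .vertex v₀)
    (hbot : ∀ n, π n ≠ .bot) (htop : ∃ n, π n = .top) :
    ∃ n F, π n = .proposal F ∧ π (n + 1) = .top ∧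
      challengerPayoff ch v₀ π = ((F.x i : ℝ) : EReal) := by
  have hex : ∃ nF : ℕ × ConsFamily G lam β, π nF.1 = .proposal nF.2 ∧ π (nF.1 + 1) = .top := by
    by_contra! hcon
    obtain ⟨n, hn⟩ := htop
    induction n with
    | zero => rw [h0] at hn; cases hn
    | succ n ih =>
      have he := hedge n
      rw [hn] at he
      generalize hs : π n = s at he
      cases he with
      | accept F => exact hcon (n, F) hs hn
      | topLoop => exact ih hs
  refine ⟨hex.choose.1, hex.choose.2, hex.choose_spec.1, hex.choose_spec.2, ?_⟩
  rw [challengerPayoff, if_neg (not_exists.2 hbot), dotPlay, dif_pos hex,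
    MeanPayoffGame.mu_appendPlay, (ch.tail_spec _).2.1]

theorem challengerPayoff_of_endless (hπ : IsEndless π) :
    challengerPayoff ch v₀ π = (G.mu i (limitWord v₀ (dotHist ch π)) : EReal) := by
  rw [challengerPayoff, if_neg fun ⟨n, hn⟩ => hπ.ne_bot n hn, dotPlay,
    dif_neg fun ⟨nF, hn⟩ => hπ.ne_top _ hn.2]

theorem ThresholdEdge.exists (α : ℝ) (s : RedState G lam i β) : ∃ t, ThresholdEdge α s t := by
  cases s with
  | vertex v => exact ⟨_, .giveUp v⟩
  | proposal F =>
    by_cases h : α < (F.x i : ℝ)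
    · exact ⟨.bot, by simp [ThresholdEdge, h]⟩
    · exact ⟨.top, by simpa [ThresholdEdge, h] using RedEdge.accept F⟩
  | pre h' v hp => exact ⟨_, .preBack h' v hp⟩
  | post c u hp => exact ⟨_, .postBack c u hp⟩
  | top => exact ⟨_, .topLoop⟩
  | bot => exact ⟨_, .botLoop⟩

theorem thresholdEdge_iff (α : ℝ) {s t : RedState G lam i β}
    (h : ∀ F, s = .proposal F → ¬ α < (F.x i : ℝ)) : ThresholdEdge α s t ↔ RedEdge s t := by
  cases s with
  | proposal F => simp [ThresholdEdge, h F rfl]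
  | _ => rfl

/-- For each threshold, up to `ε`, one of the players has a positional winning strategy. -/
theorem positional_determinacy [Finite V] (ch : Choices G lam i β) (v₀ : V) (α : ℝ) {ε : ℝ}
    (hε : 0 < ε) :
    (∃ f : RedState G lam i β → RedState G lam i β,
      (∀ s, s.role = .prover → RedEdge s (f s)) ∧
      ∀ π : ℕ → RedState G lam i β, π 0 = .vertex v₀ → (∀ n, RedEdge (π n) (π (n + 1))) →
        (∀ n, (π n).role = .prover → π (n + 1) = f (π n)) →
        challengerPayoff ch v₀ π ≤ ((α + ε : ℝ) : EReal)) ∨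
    (∃ f : RedState G lam i β → RedState G lam i β,
      (∀ s, s.role = .challenger → RedEdge s (f s)) ∧
      ∀ π : ℕ → RedState G lam i β, π 0 = .vertex v₀ → (∀ n, RedEdge (π n) (π (n + 1))) →
        (∀ n, (π n).role = .challenger → π (n + 1) = f (π n)) →
        (α : EReal) ≤ challengerPayoff ch v₀ π) := by
  classical
  obtain ⟨M, hM0, hM⟩ : ∃ M : ℝ, 0 ≤ M ∧ ∀ a b, |(G.reward i a b : ℝ) - α| ≤ M := by
    obtain ⟨M, hM0, hM⟩ := G.exists_reward_bound i
    exact ⟨M + |α|, by positivity, fun a b => (abs_sub _ _).trans (by gcongr; exact hM a b)⟩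
  obtain ⟨D, hDF, hD, hDp⟩ := ch.exists_length_bound
  obtain ⟨N, hN⟩ := exists_not_frequently_drop (RedState G lam i β)
  obtain ⟨K, hK1, hK2⟩ : ∃ K : ℝ, N * (M * (D + 1) + 1) + 1 ≤ K ∧ M * (D + 1) ≤ K :=
    ⟨_, le_max_left _ _, le_max_right _ _⟩
  -- `ε' < 1` keeps `⊥`, whose loop has weight `1`, out of `W`; the factor `3` is that of
  -- `IsEndless.mu_le`.
  obtain ⟨ε', hε0, hε1, hε3⟩ : ∃ ε' : ℝ, 0 < ε' ∧ ε' < 1 ∧ 3 * ε' ≤ ε := by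
    refine ⟨min (1 / 2) (ε / 3), by positivity, (min_le_left _ _).trans_lt (by norm_num), ?_⟩
    linarith [min_le_right (1 / 2) (ε / 3)]
  set w : RedState G lam i β → RedState G lam i β → ℝ :=
    redWeight (fun a b => (G.reward i a b : ℝ) - α) K (N * K) with hw
  obtain ⟨W, φ, hWp, hWc, hCc, hCp⟩ := exists_potential (ThresholdEdge α)
    (ThresholdEdge.exists α) (fun s : RedState G lam i β => s.role = .prover) w hε0
  have hbot : RedState.bot ∉ W := by
    intro h
    have := (hWc _ h (by simp [RedState.role]) .bot RedEdge.botLoop).2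
    simp only [hw, redWeight] at this
    linarith
  -- A loop of weight `0` cannot strictly increase `φ`. Hence Challenger's moves that stay outside
  -- `W` never accept a family.
  have htop : RedState.top ∈ W := by
    by_contra h
    obtain ⟨t, -, ht, h⟩ := hCc _ h (by simp [RedState.role])
    cases ht
    simp [hw, redWeight] at h
  by_cases hv₀ : RedState.vertex v₀ ∈ W
  · left
    have hchoice : ∀ s : RedState G lam i β, ∃ t, s.role = .prover → RedEdge s t ∧
        (s ∈ W → t ∈ W ∧ w s t + φ t < φ s + ε') := by
      intro s
      cases s with
      | vertex v =>
        by_cases h : RedState.vertex v ∈ W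
        · obtain ⟨t, ht, he, hlt⟩ := hWp _ h rfl
          exact ⟨t, fun _ => ⟨he, fun _ => ⟨ht, hlt⟩⟩⟩
        · exact ⟨.bot, fun _ => ⟨.giveUp v, fun h' => absurd h' h⟩⟩
      | _ => exact ⟨.bot, fun h => by cases h⟩
    choose f hf using hchoice
    refine ⟨f, fun s hs => (hf s hs).1, fun π h0 hedge hcons => ?_⟩
    -- A family of payoff above `α` would lead to `⊥` in the variant, and `W` is closed under
    -- Challenger's moves.
    have hsmall : ∀ F : ConsFamily G lam β, RedState.proposal F ∈ W → ¬ α < (F.x i : ℝ) :=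
      fun F hF hx => hbot (hWc _ hF (by simp [RedState.role]) .bot
        (by simp [ThresholdEdge, hx])).1
    have hstep : ∀ n, π n ∈ W →
        π (n + 1) ∈ W ∧ w (π n) (π (n + 1)) + φ (π (n + 1)) < φ (π n) + ε' := by
      intro n hn
      by_cases hr : (π n).role = .prover
      · rw [hcons n hr]
        exact (hf _ hr).2 hn
      · refine hWc _ hn hr _ ((thresholdEdge_iff α fun F hF => ?_).2 (hedge n))
        exact hsmall F (hF ▸ hn)
    have hmem : ∀ n, π n ∈ W := by
      intro n
      induction n with
      | zero => rwa [h0]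
      | succ n ih => exact (hstep n ih).1
    have hnb : ∀ n, π n ≠ .bot := fun n hn => hbot (hn ▸ hmem n)
    by_cases ht : ∃ n, π n = .top
    · obtain ⟨n, F, hF, -, hpay⟩ := exists_accepted (ch := ch) hedge h0 hnb ht
      rw [hpay]
      have := hsmall F (hF ▸ hmem n)
      exact_mod_cast (not_lt.1 this).trans (by linarith)
    · have hπ : IsEndless π := ⟨hedge, ⟨v₀, h0⟩, not_exists.1 ht, hnb⟩
      rw [challengerPayoff_of_endless hπ]
      have := hπ.mu_le (ch := ch) (d := v₀) hM hM0 hD hN hK1 hε0 hε1.le φ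
        fun n => (hstep n (hmem n)).2
      exact_mod_cast this.trans (by linarith)
  · right
    -- The variant's move from a family of payoff above `α` to `⊥` does not exist in the real game;
    -- Challenger accepts instead.
    have hchoice : ∀ s : RedState G lam i β, ∃ t, s.role = .challenger → RedEdge s t ∧
        (s ∉ W → (t ∉ W ∧ φ s < w s t + φ t) ∨
          ∃ F, s = .proposal F ∧ t = .top ∧ α < (F.x i : ℝ)) := by
      intro s
      by_cases hr : s.role = .challenger
      swap
      · exact ⟨s, fun h => absurd h hr⟩
      by_cases hF : ∃ F, s = .proposal F ∧ α < (F.x i : ℝ)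
      · obtain ⟨F, rfl, hF⟩ := hF
        exact ⟨.top, fun _ => ⟨.accept F, fun _ => .inr ⟨F, rfl, rfl, hF⟩⟩⟩
      have hiff : ∀ t, ThresholdEdge α s t ↔ RedEdge s t := fun t =>
        thresholdEdge_iff α fun F hs hx => hF ⟨F, hs, hx⟩
      by_cases hs : s ∈ W
      · obtain ⟨t, ht⟩ := ThresholdEdge.exists α s
        exact ⟨t, fun _ => ⟨(hiff t).1 ht, fun h => absurd hs h⟩⟩
      · obtain ⟨t, ht, he, hlt⟩ := hCc s hs (by simp [hr])
        exact ⟨t, fun _ => ⟨(hiff t).1 he, fun _ => .inl ⟨ht, hlt⟩⟩⟩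
    choose f hf using hchoice
    refine ⟨f, fun s hs => (hf s hs).1, fun π h0 hedge hcons => ?_⟩
    have hstep : ∀ n, π n ∉ W →
        (π (n + 1) ∉ W ∧ φ (π n) < w (π n) (π (n + 1)) + φ (π (n + 1))) ∨
          ∃ F, π n = .proposal F ∧ π (n + 1) = .top ∧ α < (F.x i : ℝ) := by
      intro n hn
      cases hr : (π n).role with
      | prover =>
        refine .inl (hCp _ hn hr _ ((thresholdEdge_iff α fun F hF => ?_).2 (hedge n)))
        rw [hF] at hr
        cases hr
      | challenger =>
        rw [hcons n hr]
        exact (hf _ hr).2 hn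
    have hmem : ∀ n, π n ∉ W ∨ π n = .top := by
      intro n
      induction n with
      | zero => rw [h0]; exact .inl hv₀
      | succ n ih =>
        rcases ih with h | h
        · rcases hstep n h with h | ⟨F, -, h, -⟩
          · exact .inl h.1
          · exact .inr h
        · have he := hedge n
          rw [h] at he
          generalize π (n + 1) = t at he
          cases he
          exact .inr rfl
    by_cases hb : ∃ n, π n = .bot
    · obtain ⟨n, hn⟩ := hb
      rw [challengerPayoff_of_bot hn]
      exact le_top
    rw [not_exists] at hb
    by_cases ht : ∃ n, π n = .top
    · obtain ⟨n, F, hF, hn, hpay⟩ := exists_accepted (ch := ch) hedge h0 hb ht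
      rw [hpay]
      have hnW : π n ∉ W := (hmem n).resolve_right (by simp [hF])
      rcases hstep n hnW with h | ⟨F', hF', -, h⟩
      · exact absurd (hn ▸ htop) h.1
      · rw [hF] at hF'
        cases hF'
        exact_mod_cast h.le
    · rw [not_exists] at ht
      have hπ : IsEndless π := ⟨hedge, ⟨v₀, h0⟩, ht, hb⟩
      rw [challengerPayoff_of_endless hπ]
      have := hπ.le_mu (ch := ch) (d := v₀) hM hM0 hDF hD hDp hN hK2 le_rfl φ fun n =>
        ((hstep n ((hmem n).resolve_right (ht n))).resolve_right
          fun ⟨_, _, h, _⟩ => ht _ h).2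
      exact_mod_cast this

end Determinacy

/-! ### The best positional strategy is optimal. -/

theorem mainTheorem8 {P V : Type*} [Fintype P] [Fintype V] (G : MeanPayoffGame P V)
    (lam : V → EReal) (i : P) (v₀ : V) (hv₀ : G.owner v₀ = i) (β : ℕ)
    (ch : Choices G lam i β) :
    ∃ σ : (reducedGame G lam i β ch v₀).Strategy (RedState.vertex v₀) Role.prover,
      σ.IsMemoryless ∧ (reducedGame G lam i β ch v₀).IsOptimal σ := by
  set Γ := reducedGame G lam i β ch v₀ with hΓ
  let s₀ : RedState G lam i β := .vertex v₀
  let σ : {f : RedState G lam i β → RedState G lam i β //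
      ∀ s, s.role = .prover → RedEdge s (f s)} → Γ.Strategy s₀ Role.prover :=
    fun f => Γ.positional s₀ f.1 f.2
  have : Nonempty {f : RedState G lam i β → RedState G lam i β //
      ∀ s, s.role = .prover → RedEdge s (f s)} := by
    choose f hf using Γ.exists_edge
    exact ⟨⟨f, fun s _ => hf s⟩⟩
  obtain ⟨f, hf⟩ := Finite.exists_max fun f => ⨅ τ : Γ.Strategy s₀ Role.challenger,
    Γ.proverPayoff (σ f) τ
  refine ⟨σ f, fun _ _ _ _ _ _ => rfl, ?_⟩
  have h1 : (⨅ τ : Γ.Strategy s₀ Role.challenger, Γ.proverPayoff (σ f) τ) ≤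
      ⨆ σ : Γ.Strategy s₀ Role.prover, ⨅ τ : Γ.Strategy s₀ Role.challenger,
        Γ.proverPayoff σ τ :=
    le_iSup (fun σ : Γ.Strategy s₀ Role.prover => ⨅ τ : Γ.Strategy s₀ Role.challenger,
        Γ.proverPayoff σ τ) (σ f)
  have h2 := iSup_iInf_le_iInf_iSup
    (fun (σ : Γ.Strategy s₀ Role.prover) (τ : Γ.Strategy s₀ Role.challenger) =>
      Γ.proverPayoff σ τ)
  have h3 : (⨅ τ : Γ.Strategy s₀ Role.challenger, ⨆ σ : Γ.Strategy s₀ Role.prover,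
      Γ.proverPayoff σ τ) ≤ ⨅ τ : Γ.Strategy s₀ Role.challenger, Γ.proverPayoff (σ f) τ := by
    -- Take `r₁ < r₂` strictly inside the gap and apply determinacy with `α = -r₂` and `ε = r₂ -
    -- r₁`, payoffs being opposite. Prover's alternative guarantees `r₁`, beating the best
    -- positional strategy; Challenger's holds Prover to `r₂`, below `inf sup`.
    by_contra! hlt
    obtain ⟨r₁, hr₁, hlt'⟩ := EReal.lt_iff_exists_real_btwn.1 hlt
    obtain ⟨r₂, hr₁₂, hr₂⟩ := EReal.lt_iff_exists_real_btwn.1 hlt'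
    have hr : r₁ < r₂ := by exact_mod_cast hr₁₂
    rcases positional_determinacy ch v₀ (-r₂) (sub_pos.2 hr) with ⟨g, hg, hwin⟩ | ⟨g, hg, hwin⟩
    · refine absurd ((le_iInf fun τ => ?_).trans (hf ⟨g, hg⟩)) (not_le.2 hr₁)
      have := hwin (Γ.outcome s₀ (Γ.profile (σ ⟨g, hg⟩) τ)) rfl (Γ.edge_outcome _)
        fun n hn => Γ.outcome_succ _ hn
      rw [show -r₂ + (r₂ - r₁) = -r₁ by ring, EReal.coe_neg] at this
      exact EReal.le_neg_of_le_neg this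
    · refine absurd ((iInf_le _ (Γ.positional s₀ g hg)).trans (iSup_le fun τ => ?_))
        (not_le.2 hr₂)
      have := hwin (Γ.outcome s₀ (Γ.profile τ (Γ.positional s₀ g hg))) rfl (Γ.edge_outcome _)
        fun n hn => Γ.outcome_succ _ hn
      rw [EReal.coe_neg] at this
      exact EReal.neg_le_of_neg_le this
  exact ⟨le_antisymm (h2.trans h3) h1, le_antisymm h3 (h1.trans h2)⟩
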